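/- Let $n\ge 0$, $\Xi=\mathbb R^n\times\mathbb R^n$, with symplectic form $\sigma((x,\xi),(y,\eta))=y\cdot\xi-x\cdot\eta$ and measure $dX=(2\pi)^{-n}dx\,d\xi$; $L^2(\Xi)$ and $L^2(\Xi\times\Xi)$ are taken with respect to $dX$ and $dX\,dY$. Write $\langle u,v\rangle=\int_\Xi u(X)v(X)\,dX$ and $\langle\!\langle F,G\rangle\!\rangle=\int\!\!\int F(X,Y)G(X,Y)\,dX\,dY$ (no conjugation), and the same for the dualities between $\mathcal S'$ and $\mathcal S$, with $\mathcal S\subset\mathcal S'$ through these pairings. Let $\mathfrak e_X(Z)=e^{i\sigma(X,Z)}$ and $\widehat f(Y)=\int_\Xi e^{-i\sigma(Y,Z)}f(Z)\,dZ$. Let $\#$ be a composition law on $\mathcal S(\Xi)$ satisfying the following hypotheses. (A) $\#:\mathcal S(\Xi)\times\mathcal S(\Xi)\to\mathcal S(\Xi)$ is bilinear, associative and separately continuous, $f^\#:=\overline f$ is an involution for it, i.e. $\overline{f\#g}=\overline g\#\overline f$, and $\int_\Xi f\#g\,dX=\int_\Xi fg\,dX$ for all $f,g\in\mathcal S(\Xi)$.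 For $u\in\mathcal S'(\Xi)$ and $f,g\in\mathcal S(\Xi)$ define $u\#g,\ f\#u\in\mathcal S'(\Xi)$ by $\langle u\#g,k\rangle=\langle u,g\#k\rangle$ and $\langle f\#u,k\rangle=\langle u,k\#f\rangle$, $k\in\mathcal S(\Xi)$. (B) $f\#u\#g\in\mathcal S(\Xi)$ for all $f,g\in\mathcal S(\Xi)$, $u\in\mathcal S'(\Xi)$. (C) $\int_\Xi\langle\Theta_Z(f),g\rangle\,dZ=\int_\Xi f\,dX\int_\Xi g\,dX$ for all $f,g\in\mathcal S(\Xi)$, where $\Theta_Z(f)=\mathfrak e_{-Z}\#f\#\mathfrak e_Z\in\mathcal S'(\Xi)$ is given by $\langle\Theta_Z(f),g\rangle=\langle\mathfrak e_{-Z},f\#\mathfrak e_Z\#g\rangle$. Let $h\in\mathcal S(\Xi)$ satisfy $h\#h=h=\overline h\ne0$. Then: (1) $\#$ extends uniquely to a continuous bilinear map $\#:L^2(\Xi)\times L^2(\Xi)\to L^2(\Xi)$, and $(L^2(\Xi),\#,^\#)$ with $f^\#=\overline f$ is a $^*$-algebra. Also $(L^2(\Xi\times\Xi),\diamond,^\diamond)$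 is a $^*$-algebra, where $$(F\diamond G)(X,Y)=\int_\Xi F(X,Z)\,G(X-Z,Y-Z)\,dZ,\qquad F^\diamond(X,Y)=\overline{F(X-Y,-Y)}.$$ (2) There is a unique continuous linear map $\mathbf M:L^2(\Xi\times\Xi)\to L^2(\Xi\times\Xi)$ of the form $[\mathbf M(F)](X,Y)=[\mathbf N(F)](-X,X-Y)$, where $\mathbf N$ is a continuous linear map on $L^2(\Xi\times\Xi)$ with $$\langle\!\langle\mathbf N(f_1\otimes f_2),g_1\otimes g_2\rangle\!\rangle=\langle\widehat g_1\#f_1,\widehat g_2\#f_2\rangle\qquad\text{for all } f_1,f_2,g_1,g_2\in\mathcal S(\Xi).$$ (3) The map $\mathbf M_h:L^2(\Xi)\to L^2(\Xi\times\Xi)$, $\mathbf M_h(f)=\mathbf M(f\otimes h)$, is an injective morphism of $^*$-algebras from $(L^2(\Xi),\#,^\#)$ to $(L^2(\Xi\times\Xi),\diamond,^\diamond)$: it is linear and injective, $\mathbf M_h(f\#g)=\mathbf M_h(f)\diamond\mathbf M_h(g)$ and $\mathbf M_h(f^\#)=\mathbf M_h(f)^\diamond$ for all $f,g\in L^2(\Xi)$;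 and $\mathbf M_h(f)\in\mathcal S(\Xi\times\Xi)$ for every $f\in\mathcal S(\Xi)$. -/

import Mathlib

open MeasureTheory
open scoped SchwartzMap ENNReal

set_option linter.unusedSectionVars false

noncomputable section

namespace ModulationMap

/-- The configuration space `𝒳 = ℝⁿ`. -/
abbrev Conf (n : ℕ) : Type := EuclideanSpace ℝ (Fin n)

section

variable (E : Type*) [NormedAddCommGroup E] [InnerProductSpace ℝ E] [FiniteDimensional ℝ E]
  [MeasurableSpace E] [BorelSpace E]

/-- The phase space `Ξ = 𝒳 × 𝒳'` over a finite-dimensional Euclidean space `𝒳`, with points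
`X = (x, ξ)`; the dual `𝒳'` is identified with `𝒳` by the scalar product. -/
abbrev Phase (E : Type*) : Type _ := E × E

variable {E} in
/-- The symplectic form `σ((x, ξ), (y, η)) = y · ξ - x · η`. -/
def symp (X Y : Phase E) : ℝ := inner ℝ Y.1 X.2 - inner ℝ X.1 Y.2

/-- The measure `dX = (2π)⁻ⁿ dx dξ` on `Ξ`, `n = dim 𝒳`; with this normalization the symplectic
Fourier transformation is unitary and squares to the identity. -/
def dX : Measure (Phase E) :=
  ENNReal.ofReal (((2 * Real.pi) ^ Module.finrank ℝ E)⁻¹) • (volume : Measure (E × E))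

instance instIsAddHaarMeasure_dX : (dX E).IsAddHaarMeasure := by
  have h : (volume : Measure (Phase E)).IsAddHaarMeasure :=
    Measure.prod.instIsAddHaarMeasure volume volume
  refine Measure.IsAddHaarMeasure.smul _ ?_ ENNReal.ofReal_ne_top
  have : (0 : ℝ) < ((2 * Real.pi) ^ Module.finrank ℝ E)⁻¹ := by positivity
  simpa using this

instance instSFinite_dX : SFinite (dX E) := inferInstance

/-- The measure `dX dY` on `Ξ × Ξ`. -/
abbrev dXdY : Measure (Phase E × Phase E) := (dX E).prod (dX E)

instance instIsAddHaarMeasure_dXdY : (dXdY E).IsAddHaarMeasure :=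
  Measure.prod.instIsAddHaarMeasure _ _

/-- `L²(Ξ)`. -/
abbrev L2 : Type _ := Lp ℂ 2 (dX E)

/-- `L²(Ξ × Ξ)`. -/
abbrev L2Double : Type _ := Lp ℂ 2 (dXdY E)

variable {E}

/-! ### Complex conjugation and the symplectic Fourier transformation on `𝓢(Ξ)` -/

/-- Complex conjugation on the Schwartz space. -/
def conjS (f : 𝓢(Phase E, ℂ)) : 𝓢(Phase E, ℂ) :=
  f.postcompCLM (Complex.conjCLE : ℂ →L[ℝ] ℂ)

theorem conjS_apply (f : 𝓢(Phase E, ℂ)) (X : Phase E) :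
    conjS f X = starRingEnd ℂ (f X) := rfl

variable (E) in
/-- The linear isomorphism `(y, η) ↦ (2π)⁻¹ (η, -y)` from `Ξ` to the Hilbert sum of its factors. -/
def rotateLin : Phase E ≃ₗ[ℝ] WithLp 2 (E × E) where
  toFun Y := WithLp.toLp 2 ((2 * Real.pi)⁻¹ • Y.2, -((2 * Real.pi)⁻¹ • Y.1))
  invFun W := (-((2 * Real.pi) • W.snd), (2 * Real.pi) • W.fst)
  map_add' Y Z := by
    apply WithLp.ofLp_injective
    ext1 <;> simp [smul_add, add_comm]
  map_smul' c Y := by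
    apply WithLp.ofLp_injective
    ext1 <;> simp [smul_comm c]
  left_inv Y := by
    have : (2 * Real.pi) * (2 * Real.pi)⁻¹ = 1 := mul_inv_cancel₀ (by positivity)
    ext1 <;> simp only [WithLp.toLp_fst, WithLp.toLp_snd, smul_smul, this, one_smul, smul_neg,
      neg_neg]
  right_inv W := by
    have : (2 * Real.pi)⁻¹ * (2 * Real.pi) = 1 := inv_mul_cancel₀ (by positivity)
    apply WithLp.ofLp_injective
    ext1
    · simp only [smul_smul, this, one_smul]
      rfl
    · simp only [smul_smul, this, one_smul, smul_neg, neg_neg]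
      rfl

variable (E) in
/-- `rotateLin` as a linear homeomorphism. -/
def rotate : Phase E ≃L[ℝ] WithLp 2 (E × E) := (rotateLin E).toContinuousLinearEquiv

variable (E) in
/-- The symplectic Fourier transformation
`(𝔉 f)(Y) = ∫ exp(-i σ(Y, Z)) f(Z) dZ` on `𝓢(Ξ)` (see `sympFourier_apply` for the formula). -/
def sympFourier : 𝓢(Phase E, ℂ) →L[ℂ] 𝓢(Phase E, ℂ) :=
  ((((2 * Real.pi) ^ Module.finrank ℝ E)⁻¹ : ℝ) : ℂ) •
    (SchwartzMap.compCLMOfContinuousLinearEquiv ℂ (rotate E) ∘L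
      SchwartzMap.fourierTransformCLM ℂ ∘L
      SchwartzMap.compCLMOfContinuousLinearEquiv ℂ
        (WithLp.prodContinuousLinearEquiv 2 ℝ E E))

theorem sympFourier_apply (f : 𝓢(Phase E, ℂ)) (Y : Phase E) :
    sympFourier E f Y = ∫ Z, Complex.exp (-(Complex.I * symp Y Z)) * f Z ∂(dX E) := by
  have h1 : sympFourier E f Y = ((((2 * Real.pi) ^ Module.finrank ℝ E)⁻¹ : ℝ) : ℂ) *
      (FourierTransform.fourier (fun v : WithLp 2 (E × E) => f (WithLp.ofLp v))) (rotate E Y) := by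
    rfl
  rw [h1, Real.fourier_eq', dX, integral_smul_measure, ENNReal.toReal_ofReal (by positivity),
    ← (WithLp.volume_preserving_ofLp E E).integral_comp
      (MeasurableEquiv.toLp 2 (E × E)).symm.measurableEmbedding, Complex.real_smul]
  congr 1
  refine integral_congr_ae (Filter.Eventually.of_forall fun v => ?_)
  have h2 : 2 * Real.pi * inner ℝ v (rotate E Y) = symp Y (WithLp.ofLp v) := by
    have : rotate E Y = WithLp.toLp 2 ((2 * Real.pi)⁻¹ • Y.2, -((2 * Real.pi)⁻¹ • Y.1)) := rfl
    rw [this, WithLp.prod_inner_apply]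
    simp only [inner_neg_right, inner_smul_right, symp]
    rw [real_inner_comm v.ofLp.2 Y.1]
    have : Real.pi ≠ 0 := Real.pi_ne_zero
    field_simp
    ring
  have h3 : -2 * Real.pi * inner ℝ v (rotate E Y) = - symp Y (WithLp.ofLp v) := by
    rw [← h2]; ring
  simp only [smul_eq_mul]
  rw [h3]
  congr 2
  push_cast
  ring

/-- The tempered distribution given by the bounded function `𝔢_X(Z) = exp(i σ(X, Z))`
(see `expDist_apply`). -/
def expDist (X : Phase E) : 𝓢'(Phase E, ℂ) :=
  PointwiseConvergenceCLM.precomp _ (sympFourier E) (TemperedDistribution.delta (-X))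

theorem expDist_apply (X : Phase E) (f : 𝓢(Phase E, ℂ)) :
    expDist X f = ∫ Z, Complex.exp (Complex.I * symp X Z) * f Z ∂(dX E) := by
  have h : expDist X f = sympFourier E f (-X) := rfl
  rw [h, sympFourier_apply]
  refine integral_congr_ae (Filter.Eventually.of_forall fun Z => ?_)
  simp only [symp, Prod.fst_neg, Prod.snd_neg, inner_neg_right, inner_neg_left]
  congr 2
  push_cast
  ring

/-! ### Abstract composition laws on `𝓢(Ξ)` -/

variable (E) in
/-- A composition law `#` on `𝓢(Ξ)`: a bilinear, associative, separately continuous product, for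
which complex conjugation is an involution, and such that `∫ f # g = ∫ f g`. -/
structure CompositionLaw where
  mul : 𝓢(Phase E, ℂ) →ₗ[ℂ] 𝓢(Phase E, ℂ) →ₗ[ℂ] 𝓢(Phase E, ℂ)
  mul_assoc : ∀ f g k, mul (mul f g) k = mul f (mul g k)
  continuous_left : ∀ f, Continuous fun g => mul f g
  continuous_right : ∀ g, Continuous fun f => mul f g
  conj_mul : ∀ f g, conjS (mul f g) = mul (conjS g) (conjS f)
  integral_mul : ∀ f g, ∫ X, mul f g X ∂(dX E) = ∫ X, f X * g X ∂(dX E)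

namespace CompositionLaw

variable (P : CompositionLaw E)

/-- `L_f : g ↦ f # g`. -/
def mulLeft (f : 𝓢(Phase E, ℂ)) : 𝓢(Phase E, ℂ) →L[ℂ] 𝓢(Phase E, ℂ) :=
  ⟨P.mul f, P.continuous_left f⟩

/-- `R_g : f ↦ f # g`. -/
def mulRight (g : 𝓢(Phase E, ℂ)) : 𝓢(Phase E, ℂ) →L[ℂ] 𝓢(Phase E, ℂ) :=
  ⟨P.mul.flip g, P.continuous_right g⟩

/-- The product `u # g` of a tempered distribution and a Schwartz function:
`⟨u # g, k⟩ = ⟨u, g # k⟩`. -/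
def distMul (u : 𝓢'(Phase E, ℂ)) (g : 𝓢(Phase E, ℂ)) : 𝓢'(Phase E, ℂ) :=
  PointwiseConvergenceCLM.precomp _ (P.mulLeft g) u

/-- The product `f # u` of a Schwartz function and a tempered distribution:
`⟨f # u, k⟩ = ⟨u, k # f⟩`. -/
def mulDist (f : 𝓢(Phase E, ℂ)) (u : 𝓢'(Phase E, ℂ)) : 𝓢'(Phase E, ℂ) :=
  PointwiseConvergenceCLM.precomp _ (P.mulRight f) u

/-- `𝓢(Ξ) # 𝓢'(Ξ) # 𝓢(Ξ) ⊆ 𝓢(Ξ)`, where `k ∈ 𝓢(Ξ)` is identified with the tempered distribution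
`g ↦ ∫ k g dX`. -/
def HypothesisB : Prop :=
  ∀ (f : 𝓢(Phase E, ℂ)) (u : 𝓢'(Phase E, ℂ)) (g : 𝓢(Phase E, ℂ)), ∃ k : 𝓢(Phase E, ℂ),
    P.distMul (P.mulDist f u) g =
      SchwartzMap.toTemperedDistributionCLM (Phase E) ℂ (dX E) k

variable {P}

/-- The (unique) Schwartz function `f # u # g`. -/
def sandwich (hB : P.HypothesisB) (f : 𝓢(Phase E, ℂ)) (u : 𝓢'(Phase E, ℂ))
    (g : 𝓢(Phase E, ℂ)) : 𝓢(Phase E, ℂ) :=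
  (hB f u g).choose

/-- The action `Θ_Z(f) = 𝔢_{-Z} # f # 𝔢_Z`, as a functional on `𝓢(Ξ)`; here
`⟨u # f # v, g⟩ = ⟨u, f # v # g⟩` for distributions `u`, `v` and Schwartz functions `f`, `g`. -/
def theta (hB : P.HypothesisB) (Z : Phase E) (f g : 𝓢(Phase E, ℂ)) : ℂ :=
  expDist (-Z) (sandwich hB f (expDist Z) g)

/-- `∫ ⟨Θ_Z(f), g⟩ dZ = ∫ f dZ · ∫ g dY` for all `f, g ∈ 𝓢(Ξ)`. -/
def HypothesisC (hB : P.HypothesisB) : Prop :=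
  ∀ f g : 𝓢(Phase E, ℂ),
    ∫ Z, theta hB Z f g ∂(dX E) = (∫ Z, f Z ∂(dX E)) * ∫ Y, g Y ∂(dX E)

end CompositionLaw

/-! ### Elementary tensors in `L²(Ξ × Ξ)` -/

theorem memLp_tensor (f g : L2 E) :
    MemLp (fun p : Phase E × Phase E => f p.1 * g p.2) 2 (dXdY E) := by
  have hf := (Lp.stronglyMeasurable f).comp_measurable
    (measurable_fst : Measurable (Prod.fst : Phase E × Phase E → Phase E))
  have hg := (Lp.stronglyMeasurable g).comp_measurable
    (measurable_snd : Measurable (Prod.snd : Phase E × Phase E → Phase E))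
  refine (memLp_two_iff_integrable_sq_norm (hf.mul hg).aestronglyMeasurable).2 ?_
  have hf2 := (memLp_two_iff_integrable_sq_norm (Lp.aestronglyMeasurable f)).1 (Lp.memLp f)
  have hg2 := (memLp_two_iff_integrable_sq_norm (Lp.aestronglyMeasurable g)).1 (Lp.memLp g)
  simpa [mul_pow] using hf2.mul_prod hg2

/-- The tensor product `f ⊗ g`, `(f ⊗ g)(X, Y) = f(X) g(Y)`. -/
def tensor (f g : L2 E) : L2Double E := (memLp_tensor f g).toLp _

/-- The map `J_h : L²(Ξ) → L²(Ξ × Ξ)`, `J_h(f) = f ⊗ h`. -/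
def windowMap (h : L2 E) : L2 E →ₗ[ℂ] L2Double E where
  toFun f := tensor f h
  map_add' f g := by
    refine Lp.ext ?_
    have hfg := (Measure.quasiMeasurePreserving_fst (μ := dX E) (ν := dX E)).ae_eq_comp (Lp.coeFn_add f g)
    filter_upwards [(memLp_tensor (f + g) h).coeFn_toLp, (memLp_tensor f h).coeFn_toLp,
      (memLp_tensor g h).coeFn_toLp, Lp.coeFn_add (tensor f h) (tensor g h), hfg]
      with p h1 h2 h3 h4 h5
    simp only [Function.comp_apply, Pi.add_apply] at h5
    rw [h4, Pi.add_apply]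
    simp only [tensor]
    rw [h1, h2, h3, h5, add_mul]
  map_smul' c f := by
    rw [RingHom.id_apply]
    refine Lp.ext ?_
    have hcf := (Measure.quasiMeasurePreserving_fst (μ := dX E) (ν := dX E)).ae_eq_comp (Lp.coeFn_smul c f)
    filter_upwards [(memLp_tensor (c • f) h).coeFn_toLp, (memLp_tensor f h).coeFn_toLp,
      Lp.coeFn_smul c (tensor f h), hcf] with p h1 h2 h4 h5
    simp only [Function.comp_apply, Pi.smul_apply] at h5
    rw [h4, Pi.smul_apply]
    simp only [tensor]
    rw [h1, h2, h5, smul_mul_assoc]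

/-! ### The crossed product structure on `L²(Ξ × Ξ)` -/

/-- The crossed product `(F ⋄ G)(X, Y) = ∫ F(X, Z) G(X - Z, Y - Z) dZ` of two functions. -/
def crossed (F G : Phase E × Phase E → ℂ) (p : Phase E × Phase E) : ℂ :=
  ∫ Z, F (p.1, Z) * G (p.1 - Z, p.2 - Z) ∂(dX E)

theorem memLp_crossed (F G : L2Double E) : MemLp (crossed F G) 2 (dXdY E) := by
  have hF := Lp.stronglyMeasurable F
  have hG := Lp.stronglyMeasurable G
  have hH : StronglyMeasurable (fun q : (Phase E × Phase E) × Phase E =>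
      F (q.1.1, q.2) * G (q.1.1 - q.2, q.1.2 - q.2)) :=
    (hF.comp_measurable (by fun_prop)).mul (hG.comp_measurable (by fun_prop))
  have hmeas : StronglyMeasurable (crossed F G) := hH.integral_prod_right'
  have hFe : Measurable fun q : Phase E × Phase E => ‖F q‖ₑ ^ (2 : ℝ) :=
    hF.measurable.enorm.pow_const _
  have hGe : Measurable fun q : Phase E × Phase E => ‖G q‖ₑ ^ (2 : ℝ) :=
    hG.measurable.enorm.pow_const _
  have hfin : ∀ K : L2Double E, ∫⁻ q, ‖K q‖ₑ ^ (2 : ℝ) ∂(dXdY E) < ∞ := fun K => by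
    simpa using lintegral_rpow_enorm_lt_top_of_eLpNorm_lt_top (by simp) (by simp) (Lp.memLp K).2
  refine ⟨hmeas.aestronglyMeasurable,
    (eLpNorm_lt_top_iff_lintegral_rpow_enorm_lt_top (by simp) (by simp)).2 ?_⟩
  have hpt : ∀ p : Phase E × Phase E, ‖crossed F G p‖ₑ ^ (2 : ℝ) ≤
      (∫⁻ Z, ‖F (p.1, Z)‖ₑ ^ (2 : ℝ) ∂(dX E)) *
        ∫⁻ Z, ‖G (p.1 - Z, p.2 - Z)‖ₑ ^ (2 : ℝ) ∂(dX E) := by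
    intro p
    have h1 : ‖crossed F G p‖ₑ ≤
        ∫⁻ Z, ((fun Z => ‖F (p.1, Z)‖ₑ) * fun Z => ‖G (p.1 - Z, p.2 - Z)‖ₑ) Z ∂(dX E) := by
      refine (enorm_integral_le_lintegral_enorm _).trans (le_of_eq ?_)
      simp
    have h2 := ENNReal.lintegral_mul_le_Lp_mul_Lq (dX E) Real.HolderConjugate.two_two
      (f := fun Z => ‖F (p.1, Z)‖ₑ) (g := fun Z => ‖G (p.1 - Z, p.2 - Z)‖ₑ)
      (hF.measurable.enorm.comp (by fun_prop)).aemeasurable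
      (hG.measurable.enorm.comp (by fun_prop)).aemeasurable
    refine (ENNReal.rpow_le_rpow (h1.trans h2) (by norm_num)).trans (le_of_eq ?_)
    rw [ENNReal.mul_rpow_of_nonneg _ _ (by norm_num), ← ENNReal.rpow_mul, ← ENNReal.rpow_mul]
    norm_num
  have hinner : ∀ X : Phase E,
      ∫⁻ Y, ∫⁻ Z, ‖G (X - Z, Y - Z)‖ₑ ^ (2 : ℝ) ∂(dX E) ∂(dX E) =
        ∫⁻ q, ‖G q‖ₑ ^ (2 : ℝ) ∂(dXdY E) := by
    intro X
    have hm : Measurable (Function.uncurry fun Y Z : Phase E =>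
        ‖G (X - Z, Y - Z)‖ₑ ^ (2 : ℝ)) :=
      hGe.comp (g := fun q => ‖G q‖ₑ ^ (2 : ℝ)) (f := fun q : Phase E × Phase E =>
        (X - q.2, q.1 - q.2)) (by fun_prop)
    rw [lintegral_lintegral_swap hm.aemeasurable,
      lintegral_prod _ hGe.aemeasurable]
    have : ∀ Z : Phase E, ∫⁻ Y, ‖G (X - Z, Y - Z)‖ₑ ^ (2 : ℝ) ∂(dX E) =
        ∫⁻ Y, ‖G (X - Z, Y)‖ₑ ^ (2 : ℝ) ∂(dX E) := fun Z =>
      lintegral_sub_right_eq_self (fun Y => ‖G (X - Z, Y)‖ₑ ^ (2 : ℝ)) Z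
    simp only [this]
    exact lintegral_sub_left_eq_self (fun W => ∫⁻ Y, ‖G (W, Y)‖ₑ ^ (2 : ℝ) ∂(dX E)) X
  have hmG : Measurable fun p : Phase E × Phase E =>
      ∫⁻ Z, ‖G (p.1 - Z, p.2 - Z)‖ₑ ^ (2 : ℝ) ∂(dX E) :=
    Measurable.lintegral_prod_right' (f := fun q : (Phase E × Phase E) × Phase E =>
      ‖G (q.1.1 - q.2, q.1.2 - q.2)‖ₑ ^ (2 : ℝ)) (hGe.comp (by fun_prop))
  have hmF : Measurable fun X : Phase E => ∫⁻ Z, ‖F (X, Z)‖ₑ ^ (2 : ℝ) ∂(dX E) :=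
    hFe.lintegral_prod_right'
  calc ∫⁻ p, ‖crossed F G p‖ₑ ^ (2 : ℝ≥0∞).toReal ∂(dXdY E)
      ≤ ∫⁻ p, (∫⁻ Z, ‖F (p.1, Z)‖ₑ ^ (2 : ℝ) ∂(dX E)) *
          ∫⁻ Z, ‖G (p.1 - Z, p.2 - Z)‖ₑ ^ (2 : ℝ) ∂(dX E) ∂(dXdY E) :=
        lintegral_mono fun p => by simpa using hpt p
    _ = ∫⁻ X, (∫⁻ Z, ‖F (X, Z)‖ₑ ^ (2 : ℝ) ∂(dX E)) *
          ∫⁻ q, ‖G q‖ₑ ^ (2 : ℝ) ∂(dXdY E) ∂(dX E) := by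
        have hm : Measurable fun p : Phase E × Phase E =>
            (∫⁻ Z, ‖F (p.1, Z)‖ₑ ^ (2 : ℝ) ∂(dX E)) *
              ∫⁻ Z, ‖G (p.1 - Z, p.2 - Z)‖ₑ ^ (2 : ℝ) ∂(dX E) :=
          (hmF.comp measurable_fst).mul hmG
        rw [lintegral_prod _ hm.aemeasurable]
        refine lintegral_congr fun X => ?_
        rw [← hinner X]
        have hm' : Measurable fun Y : Phase E =>
            ∫⁻ Z, ‖G (X - Z, Y - Z)‖ₑ ^ (2 : ℝ) ∂(dX E) := hmG.comp measurable_prodMk_left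
        dsimp only
        exact lintegral_const_mul _ hm'
    _ = (∫⁻ q, ‖F q‖ₑ ^ (2 : ℝ) ∂(dXdY E)) * ∫⁻ q, ‖G q‖ₑ ^ (2 : ℝ) ∂(dXdY E) := by
        rw [lintegral_mul_const _ hmF, ← lintegral_prod _ hFe.aemeasurable]
    _ < ∞ := ENNReal.mul_lt_top (hfin F) (hfin G)

/-- The crossed product composition `⋄` on `L²(Ξ × Ξ)`. -/
def diamond (F G : L2Double E) : L2Double E := (memLp_crossed F G).toLp _

variable (E) in
theorem measurePreserving_involution :
    MeasurePreserving (fun p : Phase E × Phase E => (p.1 - p.2, -p.2)) (dXdY E) (dXdY E) :=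
  ((MeasurePreserving.id (dX E)).prod (Measure.measurePreserving_neg (dX E))).comp
    (measurePreserving_sub_prod (dX E) (dX E))

/-- The involution `F^⋄(X, Y) = conj F(X - Y, -Y)` on `L²(Ξ × Ξ)`. -/
def diamondInv (F : L2Double E) : L2Double E :=
  star (Lp.compMeasurePreserving _ (measurePreserving_involution E) F)

/-! ### The `L²`-extensions of `#` and of the modulation mapping -/

/-- `m` is the continuous bilinear extension of `#` from `𝓢(Ξ)` to `L²(Ξ)`. -/
def IsL2Product (P : CompositionLaw E) (m : L2 E →L[ℂ] L2 E →L[ℂ] L2 E) : Prop :=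
  ∀ f g : 𝓢(Phase E, ℂ), m (f.toLp 2 (dX E)) (g.toLp 2 (dX E)) = (P.mul f g).toLp 2 (dX E)

/-- `N` is the (unique, by density) continuous linear map on `L²(Ξ × Ξ)` determined by
`⟪N(f₁ ⊗ f₂), g₁ ⊗ g₂⟫ = ⟨𝔉g₁ # f₁, 𝔉g₂ # f₂⟩` for Schwartz functions, where
`⟨·,·⟩` and `⟪·,·⟫` denote integration of the product of two functions (without conjugation). -/
def IsNMap (P : CompositionLaw E) (N : L2Double E →L[ℂ] L2Double E) : Prop :=
  ∀ f₁ f₂ g₁ g₂ : 𝓢(Phase E, ℂ),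
    ∫ p, N (tensor (f₁.toLp 2 (dX E)) (f₂.toLp 2 (dX E))) p * (g₁ p.1 * g₂ p.2) ∂(dXdY E) =
      ∫ X, P.mul (sympFourier E g₁) f₁ X * P.mul (sympFourier E g₂) f₂ X ∂(dX E)

/-- `M` is the modulation mapping on `L²(Ξ × Ξ)`: `[M(F)](X, Y) = [N(F)](-X, X - Y)`. On
elementary tensors this reads `[M(f ⊗ g)](X, Y) = ⟨𝔢_{-X} # f, 𝔢_{X-Y} # g⟩`. -/
def IsModulation (P : CompositionLaw E) (M : L2Double E →L[ℂ] L2Double E) : Prop :=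
  ∃ N : L2Double E →L[ℂ] L2Double E, IsNMap P N ∧
    ∀ F : L2Double E, M F =ᵐ[dXdY E] fun p => N F (-p.1, p.1 - p.2)

/-- The localized mapping `M_h = M ∘ J_h`, `M_h(f) = M(f ⊗ h)`. -/
def localized (M : L2Double E →L[ℂ] L2Double E) (h : 𝓢(Phase E, ℂ)) :
    L2 E →ₗ[ℂ] L2Double E :=
  M.toLinearMap ∘ₗ windowMap (h.toLp 2 (dX E))

/-! ### `*`-algebras and their morphisms, with the operations made explicit -/

/-- The product `mul` and the involution `inv` make the complex vector space `A` an (associative,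
not necessarily unital) complex `*`-algebra. -/
structure IsStarAlgebra {A : Type*} [AddCommGroup A] [Module ℂ A]
    (mul : A → A → A) (inv : A → A) : Prop where
  add_mul : ∀ a b c, mul (a + b) c = mul a c + mul b c
  mul_add : ∀ a b c, mul a (b + c) = mul a b + mul a c
  smul_mul : ∀ (z : ℂ) a b, mul (z • a) b = z • mul a b
  mul_smul : ∀ (z : ℂ) a b, mul a (z • b) = z • mul a b
  mul_assoc : ∀ a b c, mul (mul a b) c = mul a (mul b c)
  inv_add : ∀ a b, inv (a + b) = inv a + inv b
  inv_smul : ∀ (z : ℂ) a, inv (z • a) = starRingEnd ℂ z • inv a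
  inv_inv : ∀ a, inv (inv a) = a
  inv_mul : ∀ a b, inv (mul a b) = mul (inv b) (inv a)

/-- The linear map `φ` intertwines the products and the involutions. -/
structure IsStarAlgebraMorphism {A B : Type*} [AddCommGroup A] [Module ℂ A]
    [AddCommGroup B] [Module ℂ B] (mulA : A → A → A) (invA : A → A)
    (mulB : B → B → B) (invB : B → B) (φ : A →ₗ[ℂ] B) : Prop where
  map_mul : ∀ a b, φ (mulA a b) = mulB (φ a) (φ b)
  map_inv : ∀ a, φ (invA a) = invB (φ a)

end

end ModulationMap

end

open ModulationMap

/-! Since ∫ f # g = ∫ f g, the integral is a trace for `#`, and formally M(f ⊗ h)(X, Y) = ∫ 𝔢_{-X} #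
f # 𝔢_{X-Y} # h. Everything rests on the kernel K(W, X) = ⟨𝔢_X, f # 𝔢_W # g⟩, which is meaningful by
hypothesis (B).

K is a Schwartz function (`exists_sandwichKernel`). A derivative in either variable, or a product
with a linear functional of it, is again such a kernel, with multiplication or differentiation
operators inserted. All these kernels are bounded: after division by a polynomial weight the
characters have a common L² norm, and a ↦ f # a # g, with the weights inserted, is bounded on L² by
the closed graph theorem. A family of bounded functions closed under these operations consists of
Schwartz functions.

By Parseval and hypothesis (C), the scalar product of two kernels equals that of the corresponding
elementary tensors (`inner_sandwichKernel`). As tensors of Schwartz functions are total in L²(Ξ ×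
Ξ), N is a well-defined isometry, and so is M, which differs from N by a measure preserving change
of variables. Hence M_h is ‖h‖ times an isometry, and in particular injective.

A further use of Parseval, with h # h = h, gives M_h(f) ⋄ M_h(g) = M_h(f # g) for Schwartz f, g
(`crossed_modKernel`); reality of h gives compatibility with the involutions. As ⋄ is bounded on L²,
the product of L²(Ξ) can be defined as ‖h‖⁻² M_h^*(M_h(f) ⋄ M_h(g)). It extends `#`, and
associativity and the involution rule are pulled back through the injective map M_h. Associativity
of ⋄ itself is that of rank-one operators, after a shear of the variables. -/

noncomputable section

namespace ModulationMap

/-! ### A criterion for smooth functions on a product to be Schwartz functions -/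

section SchwartzCriterion

variable {V₁ V₂ : Type*} [NormedAddCommGroup V₁] [NormedSpace ℝ V₁] [FiniteDimensional ℝ V₁]
  [NormedAddCommGroup V₂] [NormedSpace ℝ V₂] [FiniteDimensional ℝ V₂]

/-- A class of bounded functions on `V₁ × V₂` that is stable under partial derivatives and under
multiplication by linear functionals of each of the two variables. -/
structure IsSchwartzClass (A : Set (V₁ × V₂ → ℂ)) : Prop where
  bounded : ∀ G ∈ A, ∃ C, ∀ p, ‖G p‖ ≤ C
  differentiable_left : ∀ G ∈ A, ∀ y, Differentiable ℝ fun x => G (x, y)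
  differentiable_right : ∀ G ∈ A, ∀ x, Differentiable ℝ fun y => G (x, y)
  deriv_left : ∀ G ∈ A, ∀ v, (fun p : V₁ × V₂ => fderiv ℝ (fun x => G (x, p.2)) p.1 v) ∈ A
  deriv_right : ∀ G ∈ A, ∀ v, (fun p : V₁ × V₂ => fderiv ℝ (fun y => G (p.1, y)) p.2 v) ∈ A
  mul_left : ∀ G ∈ A, ∀ l : V₁ →L[ℝ] ℝ, (fun p : V₁ × V₂ => (l p.1 : ℂ) * G p) ∈ A
  mul_right : ∀ G ∈ A, ∀ l : V₂ →L[ℝ] ℝ, (fun p : V₁ × V₂ => (l p.2 : ℂ) * G p) ∈ A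

/-- The coordinate functionals of a basis suffice, because ‖u‖ ≤ ∑ |bᵢ*(u)| ‖bᵢ‖. This converts
stability under multiplication by functionals into decay in norm. -/
theorem exists_norm_mul_le_of_forall_dual {P V : Type*} [NormedAddCommGroup V] [NormedSpace ℝ V]
    [FiniteDimensional ℝ V] (u : P → V) (r : P → ℝ) (hr : ∀ p, 0 ≤ r p)
    (h : ∀ l : V →L[ℝ] ℝ, ∃ C, ∀ p, |l (u p)| * r p ≤ C) : ∃ C, ∀ p, ‖u p‖ * r p ≤ C := by
  let b := Module.finBasis ℝ V
  choose C hC using fun i => h (b.coord i).toContinuousLinearMap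
  refine ⟨∑ i, C i * ‖b i‖, fun p => ?_⟩
  have h1 : ‖u p‖ ≤ ∑ i, |b.coord i (u p)| * ‖b i‖ := by
    conv_lhs => rw [← b.sum_repr (u p)]
    refine (norm_sum_le _ _).trans (le_of_eq ?_)
    simp [norm_smul]
  refine (mul_le_mul_of_nonneg_right h1 (hr p)).trans ?_
  rw [Finset.sum_mul]
  refine Finset.sum_le_sum fun i _ => ?_
  have := mul_le_mul_of_nonneg_right (hC i p) (norm_nonneg (b i))
  simp only [LinearMap.coe_toContinuousLinearMap'] at this
  linarith

namespace IsSchwartzClass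

variable {A : Set (V₁ × V₂ → ℂ)} (hA : IsSchwartzClass A)

include hA

/-- Each factor ‖p‖ ≤ ‖p.1‖ + ‖p.2‖ is traded for multiplications by linear functionals, which do
not leave `A`; hence the induction runs over all of `A` at once. -/
theorem decay_zero (k : ℕ) : ∀ G ∈ A, ∃ C, ∀ p, ‖p‖ ^ k * ‖G p‖ ≤ C := by
  induction k with
  | zero => simpa using hA.bounded
  | succ k ih =>
    intro G hG
    obtain ⟨C₁, h₁⟩ := exists_norm_mul_le_of_forall_dual (Prod.fst : V₁ × V₂ → V₁)
      (fun p => ‖p‖ ^ k * ‖G p‖) (fun p => by positivity) fun l => by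
        obtain ⟨C, hC⟩ := ih _ (hA.mul_left G hG l)
        refine ⟨C, fun p => le_trans (le_of_eq ?_) (hC p)⟩
        rw [norm_mul, Complex.norm_real, Real.norm_eq_abs]
        ring
    obtain ⟨C₂, h₂⟩ := exists_norm_mul_le_of_forall_dual (Prod.snd : V₁ × V₂ → V₂)
      (fun p => ‖p‖ ^ k * ‖G p‖) (fun p => by positivity) fun l => by
        obtain ⟨C, hC⟩ := ih _ (hA.mul_right G hG l)
        refine ⟨C, fun p => le_trans (le_of_eq ?_) (hC p)⟩
        rw [norm_mul, Complex.norm_real, Real.norm_eq_abs]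
        ring
    refine ⟨C₁ + C₂, fun p => ?_⟩
    have h3 : ‖p‖ ≤ ‖p.1‖ + ‖p.2‖ := by
      rw [Prod.norm_def]
      exact max_le (le_add_of_nonneg_right (norm_nonneg _)) (le_add_of_nonneg_left (norm_nonneg _))
    calc ‖p‖ ^ (k + 1) * ‖G p‖ = ‖p‖ * (‖p‖ ^ k * ‖G p‖) := by ring
      _ ≤ (‖p.1‖ + ‖p.2‖) * (‖p‖ ^ k * ‖G p‖) := by gcongr
      _ ≤ C₁ + C₂ := by
        rw [add_mul]
        exact add_le_add (h₁ p) (h₂ p)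

theorem exists_fderiv_left_le (G) (hG : G ∈ A) :
    ∃ C, ∀ p : V₁ × V₂, ‖fderiv ℝ (fun x => G (x, p.2)) p.1‖ ≤ C :=
  banach_steinhaus fun v => hA.bounded _ (hA.deriv_left G hG v)

theorem exists_fderiv_right_le (G) (hG : G ∈ A) :
    ∃ C, ∀ p : V₁ × V₂, ‖fderiv ℝ (fun y => G (p.1, y)) p.2‖ ≤ C :=
  banach_steinhaus fun v => hA.bounded _ (hA.deriv_right G hG v)

/-- The partial derivatives are bounded by Banach–Steinhaus, so `G` is Lipschitz in each variable
uniformly in the other. Joint continuity thus need not be an axiom of the class. -/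
theorem continuous (G) (hG : G ∈ A) : Continuous G := by
  obtain ⟨C₁, h₁⟩ := hA.exists_fderiv_left_le G hG
  obtain ⟨C₂, h₂⟩ := hA.exists_fderiv_right_le G hG
  have hL : LipschitzWith (C₁.toNNReal + C₂.toNNReal) G := by
    refine LipschitzWith.of_dist_le_mul fun p q => ?_
    have e1 : dist (G (p.1, p.2)) (G (q.1, p.2)) ≤ C₁.toNNReal * dist p.1 q.1 :=
      (lipschitzWith_of_nnnorm_fderiv_le (hA.differentiable_left G hG p.2) fun x => by
        rw [← NNReal.coe_le_coe]
        exact (h₁ (x, p.2)).trans (Real.le_coe_toNNReal _)).dist_le_mul p.1 q.1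
    have e2 : dist (G (q.1, p.2)) (G (q.1, q.2)) ≤ C₂.toNNReal * dist p.2 q.2 :=
      (lipschitzWith_of_nnnorm_fderiv_le (hA.differentiable_right G hG q.1) fun y => by
        rw [← NNReal.coe_le_coe]
        exact (h₂ (q.1, y)).trans (Real.le_coe_toNNReal _)).dist_le_mul p.2 q.2
    have e3 : dist p.1 q.1 ≤ dist p q := le_max_left _ _
    have e4 : dist p.2 q.2 ≤ dist p q := le_max_right _ _
    calc dist (G p) (G q) ≤ C₁.toNNReal * dist p.1 q.1 + C₂.toNNReal * dist p.2 q.2 :=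
          (dist_triangle _ (G (q.1, p.2)) _).trans (add_le_add e1 e2)
      _ ≤ C₁.toNNReal * dist p q + C₂.toNNReal * dist p q := by gcongr
      _ = _ := by push_cast; ring
  exact hL.continuous

/-- The directional partial derivatives lie in `A`, hence are jointly continuous; in finite
dimension this makes the partial derivatives continuous as operators, and the usual C¹ criterion
applies. -/
theorem hasFDerivAt (G) (hG : G ∈ A) (p : V₁ × V₂) :
    HasFDerivAt G ((fderiv ℝ (fun x => G (x, p.2)) p.1).coprod
      (fderiv ℝ (fun y => G (p.1, y)) p.2)) p := by
  have h := hasStrictFDerivAt_uncurry_coprod (𝕜 := ℝ) (u := p) (f := fun x y => G (x, y))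
    (f₁ := fun x y => fderiv ℝ (fun x' => G (x', y)) x)
    (f₂ := fun x y => fderiv ℝ (fun y' => G (x, y')) y)
    (Filter.Eventually.of_forall fun q => (hA.differentiable_left G hG q.2 q.1).hasFDerivAt)
    (Filter.Eventually.of_forall fun q => (hA.differentiable_right G hG q.1 q.2).hasFDerivAt)
    (Continuous.continuousAt (continuous_clm_apply.2 fun v =>
      hA.continuous _ (hA.deriv_left G hG v)))
    (Continuous.continuousAt (continuous_clm_apply.2 fun v =>
      hA.continuous _ (hA.deriv_right G hG v)))
  exact h.hasFDerivAt

/-- The derivative is operator valued and so outside `A`. Writing it through fixed linear maps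
applied to scalar members of `A` lets the induction on the order of differentiation stay in `A`. -/
theorem fderiv_eq_sum (G) (hG : G ∈ A) :
    ∃ (n : ℕ) (L : Fin n → ℂ →L[ℝ] (V₁ × V₂ →L[ℝ] ℂ)) (H : Fin n → V₁ × V₂ → ℂ),
      (∀ i, H i ∈ A) ∧ fderiv ℝ G = fun p => ∑ i, L i (H i p) := by
  let b₁ := Module.finBasis ℝ V₁
  let b₂ := Module.finBasis ℝ V₂
  let l₁ := fun i => (b₁.coord i).toContinuousLinearMap ∘L ContinuousLinearMap.fst ℝ V₁ V₂
  let l₂ := fun i => (b₂.coord i).toContinuousLinearMap ∘L ContinuousLinearMap.snd ℝ V₁ V₂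
  refine ⟨_, Fin.append (fun i => ContinuousLinearMap.smulRightL ℝ (V₁ × V₂) ℂ (l₁ i))
    (fun i => ContinuousLinearMap.smulRightL ℝ (V₁ × V₂) ℂ (l₂ i)),
    Fin.append (fun i p => fderiv ℝ (fun x => G (x, p.2)) p.1 (b₁ i))
      (fun i p => fderiv ℝ (fun y => G (p.1, y)) p.2 (b₂ i)), fun i => ?_, ?_⟩
  · refine Fin.addCases (fun i => ?_) (fun i => ?_) i
    · rw [Fin.append_left]; exact hA.deriv_left G hG _
    · rw [Fin.append_right]; exact hA.deriv_right G hG _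
  · ext1 p
    rw [(hA.hasFDerivAt G hG p).fderiv]
    refine ContinuousLinearMap.ext fun v => ?_
    rw [Fin.sum_univ_add]
    simp only [Fin.append_left, Fin.append_right, add_apply, sum_apply,
      ContinuousLinearMap.smulRightL_apply_apply, ContinuousLinearMap.coprod_apply]
    congr 1
    · conv_lhs => rw [← b₁.sum_repr v.1]
      simp only [map_sum, map_smul, l₁, Complex.real_smul]
      simp
    · conv_lhs => rw [← b₂.sum_repr v.2]
      simp only [map_sum, map_smul, l₂, Complex.real_smul]
      simp

theorem contDiff_and_decay (n : ℕ) : ∀ G ∈ A, ContDiff ℝ n G ∧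
    ∀ k : ℕ, ∃ C, ∀ p, ‖p‖ ^ k * ‖iteratedFDeriv ℝ n G p‖ ≤ C := by
  induction n with
  | zero =>
    intro G hG
    refine ⟨contDiff_zero.2 (hA.continuous G hG), fun k => ?_⟩
    simpa using hA.decay_zero k G hG
  | succ n ih =>
    intro G hG
    obtain ⟨m, L, H, hH, hs⟩ := hA.fderiv_eq_sum G hG
    have hLH : ∀ i, ContDiff ℝ n fun p => L i (H i p) := fun i =>
      (L i).contDiff.comp (ih _ (hH i)).1
    refine ⟨?_, fun k => ?_⟩
    · push_cast
      refine contDiff_succ_iff_fderiv.2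
        ⟨fun p => (hA.hasFDerivAt G hG p).differentiableAt, by simp, ?_⟩
      rw [hs]
      exact ContDiff.sum fun i _ => hLH i
    · choose C hC using fun i => (ih _ (hH i)).2 k
      refine ⟨∑ i, ‖L i‖ * C i, fun p => ?_⟩
      rw [← norm_iteratedFDeriv_fderiv, hs, iteratedFDeriv_fun_sum_apply
        fun i _ => (hLH i).contDiffAt]
      refine (mul_le_mul_of_nonneg_left (norm_sum_le _ _) (by positivity)).trans ?_
      rw [Finset.mul_sum]
      refine Finset.sum_le_sum fun i _ => ?_
      have h1 := (L i).norm_iteratedFDeriv_comp_left (f := H i) (x := p)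
        (ih _ (hH i)).1.contDiffAt le_rfl
      calc ‖p‖ ^ k * ‖iteratedFDeriv ℝ n (fun q => L i (H i q)) p‖
          ≤ ‖p‖ ^ k * (‖L i‖ * ‖iteratedFDeriv ℝ n (H i) p‖) := by gcongr; exact h1
        _ = ‖L i‖ * (‖p‖ ^ k * ‖iteratedFDeriv ℝ n (H i) p‖) := by ring
        _ ≤ ‖L i‖ * C i := by gcongr; exact hC i p

theorem exists_schwartzMap (G) (hG : G ∈ A) : ∃ K : 𝓢(V₁ × V₂, ℂ), ∀ p, K p = G p :=
  ⟨⟨G, contDiff_infty.2 fun n => (hA.contDiff_and_decay n G hG).1,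
    fun k n => (hA.contDiff_and_decay n G hG).2 k⟩, fun _ => rfl⟩

end IsSchwartzClass

end SchwartzCriterion

/-! ### The symplectic Fourier transformation -/

section SymplecticFourier

variable {E : Type*} [NormedAddCommGroup E] [InnerProductSpace ℝ E] [FiniteDimensional ℝ E]
  [MeasurableSpace E] [BorelSpace E]

/-- The linear functional `Z ↦ σ(X, Z)`. -/
def sympL (X : Phase E) : Phase E →L[ℝ] ℝ :=
  innerSL ℝ X.2 ∘L ContinuousLinearMap.fst ℝ E E - innerSL ℝ X.1 ∘L ContinuousLinearMap.snd ℝ E E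

theorem sympL_apply (X Z : Phase E) : sympL X Z = symp X Z := by
  simp [sympL, symp, real_inner_comm]

theorem symp_comm (X Y : Phase E) : symp X Y = -symp Y X := by
  rw [symp, symp, neg_sub, real_inner_comm]

theorem symp_add_left (X Y Z : Phase E) : symp (X + Y) Z = symp X Z + symp Y Z := by
  simp only [symp, Prod.fst_add, Prod.snd_add, inner_add_left, inner_add_right]
  ring

theorem symp_smul_left (t : ℝ) (X Z : Phase E) : symp (t • X) Z = t * symp X Z := by
  simp only [symp, Prod.smul_fst, Prod.smul_snd, inner_smul_right, real_inner_smul_left]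
  ring

theorem symp_neg_left (X Z : Phase E) : symp (-X) Z = -symp X Z := by
  simp only [symp, Prod.fst_neg, Prod.snd_neg, inner_neg_left, inner_neg_right]
  ring

/-- Nondegeneracy of σ, by Riesz representation in each factor. -/
theorem exists_eq_symp (l : Phase E →L[ℝ] ℝ) : ∃ v : Phase E, ∀ X, l X = symp X v := by
  let a := (InnerProductSpace.toDual ℝ E).symm (l ∘L ContinuousLinearMap.inl ℝ E E)
  let b := (InnerProductSpace.toDual ℝ E).symm (l ∘L ContinuousLinearMap.inr ℝ E E)
  refine ⟨(b, -a), fun X => ?_⟩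
  have ha : inner ℝ a X.1 = l (X.1, 0) := by
    simp [a, InnerProductSpace.toDual_symm_apply]
  have hb : inner ℝ b X.2 = l (0, X.2) := by
    simp [b, InnerProductSpace.toDual_symm_apply]
  have h : X = (X.1, 0) + (0, X.2) := by simp
  simp only [symp, inner_neg_right]
  rw [real_inner_comm, ha] at *
  rw [hb]
  conv_lhs => rw [h, map_add]
  ring

/-- The function `𝔢_X(Z) = exp(i σ(X, Z))`. -/
def character (X Z : Phase E) : ℂ := Complex.exp (Complex.I * symp X Z)

theorem norm_character (X Z : Phase E) : ‖character X Z‖ = 1 := by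
  rw [character, mul_comm, Complex.norm_exp_ofReal_mul_I]

theorem conj_character (X Z : Phase E) :
    starRingEnd ℂ (character X Z) = character (-X) Z := by
  rw [character, character, ← Complex.exp_conj, map_mul, Complex.conj_I, Complex.conj_ofReal,
    symp_neg_left]
  push_cast
  ring_nf

theorem continuous_symp : Continuous fun p : Phase E × Phase E => symp p.1 p.2 := by
  unfold symp
  fun_prop

theorem continuous_character : Continuous fun p : Phase E × Phase E => character p.1 p.2 := by
  unfold character
  have := continuous_symp (E := E)
  fun_prop

theorem continuous_character_right (X : Phase E) : Continuous (character X) :=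
  continuous_character.comp (by fun_prop : Continuous fun Z => (X, Z))

theorem expDist_eq_integral (X : Phase E) (f : 𝓢(Phase E, ℂ)) :
    expDist X f = ∫ Z, character X Z * f Z ∂(dX E) :=
  expDist_apply X f

theorem sympFourier_eq_expDist (f : 𝓢(Phase E, ℂ)) (X : Phase E) :
    sympFourier E f X = expDist (-X) f := by
  have h : expDist (-X) f = sympFourier E f (- -X) := rfl
  rw [h, neg_neg]

theorem integrable_character_mul (X : Phase E) (f : 𝓢(Phase E, ℂ)) :
    Integrable (fun Z => character X Z * f Z) (dX E) := by
  refine f.integrable.bdd_mul (c := 1) (continuous_character_right X).aestronglyMeasurable ?_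
  exact Filter.Eventually.of_forall fun Z => (norm_character X Z).le

theorem conj_expDist (X : Phase E) (f : 𝓢(Phase E, ℂ)) :
    starRingEnd ℂ (expDist X f) = expDist (-X) (conjS f) := by
  rw [expDist_eq_integral, expDist_eq_integral, ← integral_conj]
  simp only [map_mul, conj_character, conjS_apply]

/-- Fubini. The reflection `-Z` comes from the antisymmetry of σ: the Fourier kernel is not
symmetric. -/
theorem integral_sympFourier_mul (a b : 𝓢(Phase E, ℂ)) :
    ∫ Y, sympFourier E a Y * b Y ∂(dX E) = ∫ Z, a Z * sympFourier E b (-Z) ∂(dX E) := by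
  have h1 : ∀ Y, sympFourier E a Y * b Y = ∫ Z, character (-Y) Z * (a Z * b Y) ∂(dX E) := fun Y => by
    rw [sympFourier_eq_expDist, expDist_eq_integral, ← integral_mul_const]
    simp only [mul_assoc]
  have h2 : ∀ Z, a Z * sympFourier E b (-Z) = ∫ Y, character (-Y) Z * (a Z * b Y) ∂(dX E) :=
    fun Z => by
      rw [sympFourier_eq_expDist, neg_neg, expDist_eq_integral, ← integral_const_mul]
      refine integral_congr_ae (Filter.Eventually.of_forall fun Y => ?_)
      have : character (-Y) Z = character Z Y := by
        rw [character, character, symp_neg_left, ← symp_comm]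
      simp only [this]
      ring
  simp only [h1, h2]
  refine integral_integral_swap ?_
  have hb : Integrable (fun p : Phase E × Phase E => a p.2 * b p.1) ((dX E).prod (dX E)) := by
    simpa only [mul_comm] using b.integrable.mul_prod a.integrable
  refine hb.bdd_mul (c := 1) (Continuous.aestronglyMeasurable ?_) ?_
  · exact continuous_character.comp (by fun_prop : Continuous fun p : Phase E × Phase E => (-p.1, p.2))
  · exact Filter.Eventually.of_forall fun p => (norm_character _ _).le

/-- Up to a volume preserving rotation, `rotate` is scaling by (2π)⁻¹ in dimension 2n. This Jacobian
later cancels the factors (2π)⁻ⁿ of `dX` and of `sympFourier`. -/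
theorem integral_comp_rotate (φ : WithLp 2 (E × E) → ℂ) :
    ∫ Z, φ (rotate E Z) ∂(volume : Measure (E × E)) =
      ((2 * Real.pi) ^ Module.finrank ℝ E) ^ 2 * ∫ w, φ w := by
  have hJ : MeasurePreserving (fun Z : E × E => (Z.2, -Z.1)) volume volume :=
    ((MeasurePreserving.id (volume : Measure E)).prod (Measure.measurePreserving_neg volume)).comp
      (Measure.measurePreserving_swap (μ := (volume : Measure E)) (ν := (volume : Measure E)))
  have hJe : MeasurableEmbedding (fun Z : E × E => (Z.2, -Z.1)) :=
    ((Homeomorph.prodComm E E).trans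
      ((Homeomorph.refl E).prodCongr (Homeomorph.neg E))).measurableEmbedding
  have h1 := hJ.integral_comp hJe (fun Z => φ (WithLp.toLp 2 ((2 * Real.pi)⁻¹ • Z)))
  have h2 : ∀ Z : E × E, rotate E Z = WithLp.toLp 2 ((2 * Real.pi)⁻¹ • (Z.2, -Z.1)) := fun Z => by
    change WithLp.toLp 2 ((2 * Real.pi)⁻¹ • Z.2, -((2 * Real.pi)⁻¹ • Z.1)) = _
    rw [Prod.smul_mk, smul_neg]
  have hH : (volume : Measure (E × E)).IsAddHaarMeasure :=
    Measure.prod.instIsAddHaarMeasure volume volume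
  simp only [h2]
  rw [h1, Measure.integral_comp_smul volume (fun Z : E × E => φ (WithLp.toLp 2 Z)),
    ← (WithLp.volume_preserving_ofLp E E).integral_comp
      (MeasurableEquiv.toLp 2 (E × E)).symm.measurableEmbedding, Module.finrank_prod,
    Complex.real_smul, abs_of_pos (by positivity)]
  congr 1
  rw [inv_pow, inv_inv, ← two_mul, pow_mul']
  push_cast
  rfl

/-- By antisymmetry of σ, exp(-iσ(Y, Z)) = exp(2πi⟨rotate Z, Y⟩); after the substitution w = rotate
Z the outer transformation is therefore the ordinary inverse Fourier transformation, with no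
reflection left. -/
theorem sympFourier_sympFourier (f : 𝓢(Phase E, ℂ)) : sympFourier E (sympFourier E f) = f := by
  ext Y
  let g : 𝓢(WithLp 2 (E × E), ℂ) := SchwartzMap.compCLMOfContinuousLinearEquiv ℂ
    (WithLp.prodContinuousLinearEquiv 2 ℝ E E) f
  have h1 : ∀ Y, sympFourier E f Y = ((((2 * Real.pi) ^ Module.finrank ℝ E)⁻¹ : ℝ) : ℂ) *
      FourierTransform.fourier g (rotate E Y) := fun Y => rfl
  have h3 : ∀ Z, Complex.exp (-(Complex.I * symp Y Z)) =
      Complex.exp ((2 * Real.pi * inner ℝ (rotate E Z) (WithLp.toLp 2 Y) : ℝ) * Complex.I) := by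
    intro Z
    have : rotate E Z = WithLp.toLp 2 ((2 * Real.pi)⁻¹ • Z.2, -((2 * Real.pi)⁻¹ • Z.1)) := rfl
    have h2 : 2 * Real.pi * inner ℝ (rotate E Z) (WithLp.toLp 2 Y) = -symp Y Z := by
      rw [this, WithLp.prod_inner_apply]
      simp only [inner_neg_left, real_inner_smul_left, symp]
      rw [real_inner_comm Z.2 Y.1]
      have : Real.pi ≠ 0 := Real.pi_ne_zero
      field_simp
      ring
    rw [h2]
    push_cast
    ring_nf
  rw [sympFourier_apply]
  simp only [h3, h1]
  rw [dX, integral_smul_measure, ENNReal.toReal_ofReal (by positivity),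
    integral_comp_rotate (fun w => Complex.exp ((2 * Real.pi * inner ℝ w (WithLp.toLp 2 Y) : ℝ) *
      Complex.I) * (((((2 * Real.pi) ^ Module.finrank ℝ E)⁻¹ : ℝ) : ℂ) *
        FourierTransform.fourier g w))]
  have h4 : ∫ w, Complex.exp ((2 * Real.pi * inner ℝ w (WithLp.toLp 2 Y) : ℝ) *
      Complex.I) * (((((2 * Real.pi) ^ Module.finrank ℝ E)⁻¹ : ℝ) : ℂ) *
        FourierTransform.fourier g w) = ((((2 * Real.pi) ^ Module.finrank ℝ E)⁻¹ : ℝ) : ℂ) *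
        g (WithLp.toLp 2 Y) := by
    have h5 : g (WithLp.toLp 2 Y) = FourierTransformInv.fourierInv (FourierTransform.fourier g)
        (WithLp.toLp 2 Y) := by
      rw [FourierTransform.fourierInv_fourier_eq]
    rw [h5, SchwartzMap.fourierInv_coe, Real.fourierInv_eq', ← integral_const_mul]
    refine integral_congr_ae (Filter.Eventually.of_forall fun w => ?_)
    simp only [smul_eq_mul]
    ring
  rw [h4, Complex.real_smul]
  have h6 : g (WithLp.toLp 2 Y) = f Y := rfl
  have h7 : ((2 * Real.pi : ℂ) ^ Module.finrank ℝ E) ≠ 0 := by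
    have : (Real.pi : ℂ) ≠ 0 := by exact_mod_cast Real.pi_ne_zero
    exact pow_ne_zero _ (mul_ne_zero two_ne_zero this)
  rw [h6]
  push_cast
  field_simp

/-- The Parseval formula. -/
theorem integral_expDist_mul_expDist_neg (a b : 𝓢(Phase E, ℂ)) :
    ∫ W, expDist W a * expDist (-W) b ∂(dX E) = ∫ Z, a Z * b Z ∂(dX E) := by
  have h := integral_sympFourier_mul (sympFourier E a) b
  rw [sympFourier_sympFourier] at h
  rw [h, ← integral_neg_eq_self]
  refine integral_congr_ae (Filter.Eventually.of_forall fun W => ?_)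
  simp only [sympFourier_eq_expDist, neg_neg]

theorem integral_expDist_mul (a b : 𝓢(Phase E, ℂ)) :
    ∫ W, expDist W a * b W ∂(dX E) = ∫ Z, a Z * sympFourier E b Z ∂(dX E) := by
  have h := integral_expDist_mul_expDist_neg a (sympFourier E b)
  simp only [← sympFourier_eq_expDist, sympFourier_sympFourier] at h
  exact h

end SymplecticFourier

/-! ### Derivatives of X ↦ ⟨𝔢_X, f⟩ and its products with linear functionals -/

section

variable {E : Type*} [NormedAddCommGroup E] [InnerProductSpace ℝ E] [FiniteDimensional ℝ E]
  [MeasurableSpace E] [BorelSpace E]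

open scoped LineDeriv

/-- Multiplication by `Z ↦ i σ(v, Z)` on `𝓢(Ξ)`. -/
def mulSymp (v : Phase E) : 𝓢(Phase E, ℂ) →L[ℂ] 𝓢(Phase E, ℂ) :=
  SchwartzMap.smulLeftCLM ℂ fun Z => Complex.I * (sympL v Z : ℂ)

theorem hasTemperateGrowth_symp (v : Phase E) :
    (fun Z : Phase E => Complex.I * (sympL v Z : ℂ)).HasTemperateGrowth := by
  have h : (fun Z : Phase E => (sympL v Z : ℂ)).HasTemperateGrowth :=
    (Complex.ofRealCLM ∘L sympL v).hasTemperateGrowth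
  fun_prop

theorem mulSymp_apply (v : Phase E) (f : 𝓢(Phase E, ℂ)) (Z : Phase E) :
    mulSymp v f Z = Complex.I * symp v Z * f Z := by
  rw [mulSymp, SchwartzMap.smulLeftCLM_apply_apply (hasTemperateGrowth_symp v), sympL_apply,
    smul_eq_mul]

theorem differentiable_expDist (f : 𝓢(Phase E, ℂ)) :
    Differentiable ℝ fun X : Phase E => expDist X f :=
  (sympFourier E f).differentiable.comp differentiable_id.neg

theorem hasDerivAt_character_line (X v Z : Phase E) (t : ℝ) :
    HasDerivAt (fun t : ℝ => character (X + t • v) Z)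
      (character (X + t • v) Z * (Complex.I * symp v Z)) t := by
  have h1 : HasDerivAt (fun t : ℝ => Complex.I * ((symp (X + t • v) Z : ℝ) : ℂ))
      (Complex.I * symp v Z) t := by
    simp only [symp_add_left, symp_smul_left]
    have h2 : HasDerivAt (fun t : ℝ => symp X Z + t * symp v Z) (symp v Z) t := by
      simpa using ((hasDerivAt_id t).mul_const (symp v Z)).const_add (symp X Z)
    exact h2.ofReal_comp.const_mul _
  exact h1.cexp

theorem fderiv_expDist (f : 𝓢(Phase E, ℂ)) (X v : Phase E) :
    fderiv ℝ (fun X : Phase E => expDist X f) X v = expDist X (mulSymp v f) := by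
  have h1 : HasDerivAt (fun t : ℝ => expDist (X + t • v) f)
      (fderiv ℝ (fun X : Phase E => expDist X f) X v) 0 := by
    have hl : HasDerivAt (fun t : ℝ => X + t • v) v 0 := by
      simpa using ((hasDerivAt_id (0 : ℝ)).smul_const v).const_add X
    have hd : HasFDerivAt (fun X : Phase E => expDist X f)
        (fderiv ℝ (fun X : Phase E => expDist X f) X) (X + (0 : ℝ) • v) := by
      simpa using (differentiable_expDist f X).hasFDerivAt
    exact hd.comp_hasDerivAt (0 : ℝ) hl
  have h2 := (hasDerivAt_integral_of_dominated_loc_of_deriv_le (μ := dX E) (x₀ := (0 : ℝ))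
    (s := Set.univ) (F := fun t Z => character (X + t • v) Z * f Z)
    (F' := fun t Z => character (X + t • v) Z * (Complex.I * symp v Z) * f Z)
    (bound := fun Z => ‖mulSymp v f Z‖) Filter.univ_mem
    (Filter.Eventually.of_forall fun t => (integrable_character_mul _ f).aestronglyMeasurable)
    (integrable_character_mul _ f)
    (by
      simpa only [mulSymp_apply, ← mul_assoc] using
        (integrable_character_mul (X + (0 : ℝ) • v) (mulSymp v f)).aestronglyMeasurable)
    (Filter.Eventually.of_forall fun Z t _ => by
      rw [mulSymp_apply, mul_assoc, norm_mul, norm_character, one_mul])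
    (mulSymp v f).integrable.norm
    (Filter.Eventually.of_forall fun Z t _ =>
      (hasDerivAt_character_line X v Z t).mul_const (f Z))).2
  simp only [← expDist_eq_integral] at h2
  rw [h1.unique h2, expDist_eq_integral]
  refine integral_congr_ae (Filter.Eventually.of_forall fun Z => ?_)
  simp only [zero_smul, add_zero, mulSymp_apply]
  ring

/-- Integration by parts, as ∂_v 𝔢_X = iσ(X, v) 𝔢_X. Together with `fderiv_expDist` it moves every
derivative or multiplication in X onto the Schwartz function. -/
theorem symp_mul_expDist (f : 𝓢(Phase E, ℂ)) (X v : Phase E) :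
    Complex.I * symp X v * expDist X f = -expDist X (∂_{v} f) := by
  have hd : ∀ Z, HasFDerivAt (character X)
      (character X Z • (Complex.I • (Complex.ofRealCLM ∘L sympL X))) Z := fun Z => by
    have h : HasFDerivAt (fun Z => Complex.I • (Complex.ofRealCLM ∘L sympL X) Z)
        (Complex.I • (Complex.ofRealCLM ∘L sympL X)) Z :=
      (Complex.ofRealCLM ∘L sympL X).hasFDerivAt.const_smul Complex.I
    have h2 := h.cexp
    have h3 : (fun Z => Complex.exp (Complex.I • (Complex.ofRealCLM ∘L sympL X) Z)) =
        character X := by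
      ext Z
      simp [character, sympL_apply]
    rw [h3] at h2
    rwa [congrFun h3 Z] at h2
  have hv : ∀ Z, fderiv ℝ (character X) Z v = character X Z * (Complex.I * symp X v) := fun Z => by
    rw [(hd Z).fderiv]
    simp [sympL_apply]
  have hf : ∀ Z, fderiv ℝ f Z v = (∂_{v} f) Z := fun Z =>
    (SchwartzMap.lineDerivOp_apply_eq_fderiv v f Z).symm
  have h := integral_mul_fderiv_eq_neg_fderiv_mul_of_integrable (μ := dX E) (v := v)
    (f := character X) (g := f)
    (by
      simp only [hv]
      refine ((integrable_character_mul X f).const_mul (Complex.I * symp X v)).congr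
        (Filter.Eventually.of_forall fun Z => ?_)
      simp only
      ring)
    (by simpa only [hf] using integrable_character_mul X (∂_{v} f))
    (integrable_character_mul X f) (fun Z _ => (hd Z).differentiableAt)
    (fun Z _ => f.differentiableAt)
  simp only [hv, hf] at h
  rw [expDist_eq_integral X (∂_{v} f), h, neg_neg, expDist_eq_integral, ← integral_const_mul]
  refine integral_congr_ae (Filter.Eventually.of_forall fun Z => ?_)
  simp only
  ring

/-! ### Operators on `𝓢(Ξ)` with a transpose -/

/-- `D'` is the transpose of `D` for the pairing `∫ f g dX`. -/
def IsTranspose (D D' : 𝓢(Phase E, ℂ) →L[ℂ] 𝓢(Phase E, ℂ)) : Prop :=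
  ∀ f g, ∫ X, D f X * g X ∂(dX E) = ∫ X, f X * D' g X ∂(dX E)

/-- `D` has a transpose for the pairing `∫ f g dX`. -/
def HasTranspose (D : 𝓢(Phase E, ℂ) →L[ℂ] 𝓢(Phase E, ℂ)) : Prop := ∃ D', IsTranspose D D'

theorem HasTranspose.id : HasTranspose (ContinuousLinearMap.id ℂ 𝓢(Phase E, ℂ)) :=
  ⟨ContinuousLinearMap.id ℂ _, fun _ _ => rfl⟩

theorem HasTranspose.comp {D₁ D₂ : 𝓢(Phase E, ℂ) →L[ℂ] 𝓢(Phase E, ℂ)} (h₁ : HasTranspose D₁)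
    (h₂ : HasTranspose D₂) : HasTranspose (D₁ ∘L D₂) := by
  obtain ⟨D₁', h₁⟩ := h₁
  obtain ⟨D₂', h₂⟩ := h₂
  exact ⟨D₂' ∘L D₁', fun f g => (h₁ _ _).trans (h₂ _ _)⟩

theorem HasTranspose.smul {D : 𝓢(Phase E, ℂ) →L[ℂ] 𝓢(Phase E, ℂ)} (h : HasTranspose D) (c : ℂ) :
    HasTranspose (c • D) := by
  obtain ⟨D', h⟩ := h
  refine ⟨c • D', fun f g => ?_⟩
  have h1 : ∀ X, (c • D) f X * g X = c * (D f X * g X) := fun X => by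
    simp [mul_assoc]
  have h2 : ∀ X, f X * (c • D') g X = c * (f X * D' g X) := fun X => by
    simp only [smul_apply, smul_eq_mul]
    ring
  simp only [h1, h2, integral_const_mul, h f g]

theorem hasTranspose_smulLeftCLM {p : Phase E → ℂ} (hp : p.HasTemperateGrowth) :
    HasTranspose (SchwartzMap.smulLeftCLM ℂ p) := by
  refine ⟨SchwartzMap.smulLeftCLM ℂ p, fun f g => ?_⟩
  simp only [SchwartzMap.smulLeftCLM_apply_apply hp, smul_eq_mul]
  refine integral_congr_ae (Filter.Eventually.of_forall fun Z => ?_)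
  simp only
  ring

theorem hasTranspose_mulSymp (v : Phase E) : HasTranspose (mulSymp v) :=
  hasTranspose_smulLeftCLM (hasTemperateGrowth_symp v)

theorem hasTranspose_lineDeriv (v : Phase E) :
    HasTranspose (LineDeriv.lineDerivOpCLM ℂ 𝓢(Phase E, ℂ) v) := by
  refine ⟨-LineDeriv.lineDerivOpCLM ℂ 𝓢(Phase E, ℂ) v, fun f g => ?_⟩
  have h := SchwartzMap.integral_mul_lineDerivOp_right_eq_neg_left (μ := dX E) f g v
  simp only [LineDeriv.lineDerivOpCLM_apply, neg_apply, mul_neg, integral_neg, h, neg_neg]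

/-- Both embeddings 𝓢 → L² → 𝓢' are injective. -/
theorem schwartz_ext_of_integral {a b : 𝓢(Phase E, ℂ)}
    (h : ∀ φ : 𝓢(Phase E, ℂ), ∫ X, a X * φ X ∂(dX E) = ∫ X, b X * φ X ∂(dX E)) : a = b := by
  have hk := LinearMap.ker_eq_bot.1 (MeasureTheory.Lp.ker_toTemperedDistributionCLM_eq_bot
    (E := Phase E) (F := ℂ) (μ := dX E) (p := 2))
  refine SchwartzMap.injective_toLp 2 (dX E) (hk ?_)
  ext φ
  have key : ∀ c : 𝓢(Phase E, ℂ), Lp.toTemperedDistributionCLM ℂ (dX E) 2 (c.toLp 2 (dX E)) φ =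
      ∫ X, c X * φ X ∂(dX E) := fun c => by
    rw [Lp.toTemperedDistributionCLM_apply, Lp.toTemperedDistribution_toLp_eq,
      SchwartzMap.toTemperedDistributionCLM_apply_apply (dX E)]
    simp only [smul_eq_mul, mul_comm]
  exact (key a).trans ((h φ).trans (key b).symm)

/-! ### Algebra of f # u # g and the trace property -/

namespace CompositionLaw

variable {P : CompositionLaw E} (hB : P.HypothesisB)

theorem integral_mul_comm (f g : 𝓢(Phase E, ℂ)) :
    ∫ X, P.mul f g X ∂(dX E) = ∫ X, P.mul g f X ∂(dX E) := by
  simp only [P.integral_mul, mul_comm]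

/-- `sandwich` is obtained by choice; its pairings determine it, so each identity below is checked
against test functions, using associativity and, where needed, the trace property
`integral_mul_comm`. -/
theorem integral_sandwich_mul (f : 𝓢(Phase E, ℂ)) (u : 𝓢'(Phase E, ℂ)) (g φ : 𝓢(Phase E, ℂ)) :
    ∫ X, sandwich hB f u g X * φ X ∂(dX E) = u (P.mul (P.mul g φ) f) := by
  have h : P.distMul (P.mulDist f u) g φ = SchwartzMap.toTemperedDistributionCLM (Phase E) ℂ (dX E)
      (sandwich hB f u g) φ := by
    rw [sandwich, ← (hB f u g).choose_spec]
  rw [SchwartzMap.toTemperedDistributionCLM_apply_apply (dX E)] at h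
  simp only [smul_eq_mul, mul_comm (φ _)] at h
  exact h.symm

theorem sandwich_mul_left (a f : 𝓢(Phase E, ℂ)) (u : 𝓢'(Phase E, ℂ)) (g : 𝓢(Phase E, ℂ)) :
    sandwich hB (P.mul a f) u g = P.mul a (sandwich hB f u g) := by
  refine schwartz_ext_of_integral fun φ => ?_
  rw [integral_sandwich_mul, ← P.integral_mul, P.mul_assoc a, integral_mul_comm,
    P.mul_assoc (sandwich hB f u g), P.integral_mul, integral_sandwich_mul]
  simp only [P.mul_assoc]

theorem sandwich_mul_right (f : 𝓢(Phase E, ℂ)) (u : 𝓢'(Phase E, ℂ)) (g b : 𝓢(Phase E, ℂ)) :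
    sandwich hB f u (P.mul g b) = P.mul (sandwich hB f u g) b := by
  refine schwartz_ext_of_integral fun φ => ?_
  rw [integral_sandwich_mul, ← P.integral_mul, P.mul_assoc (sandwich hB f u g),
    P.integral_mul, integral_sandwich_mul]
  simp only [P.mul_assoc]

theorem sandwich_mul (a f : 𝓢(Phase E, ℂ)) (u : 𝓢'(Phase E, ℂ)) (g b : 𝓢(Phase E, ℂ)) :
    sandwich hB (P.mul a f) u (P.mul g b) = P.mul a (P.mul (sandwich hB f u g) b) := by
  rw [sandwich_mul_left, sandwich_mul_right]

theorem conjS_conjS (f : 𝓢(Phase E, ℂ)) : conjS (conjS f) = f := by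
  ext X
  simp [conjS_apply]

theorem conjS_sandwich (f g : 𝓢(Phase E, ℂ)) (W : Phase E) :
    conjS (sandwich hB f (expDist W) g) = sandwich hB (conjS g) (expDist (-W)) (conjS f) := by
  refine schwartz_ext_of_integral fun φ => ?_
  rw [integral_sandwich_mul]
  have h1 : ∫ X, conjS (sandwich hB f (expDist W) g) X * φ X ∂(dX E) =
      starRingEnd ℂ (∫ X, sandwich hB f (expDist W) g X * conjS φ X ∂(dX E)) := by
    rw [← integral_conj]
    simp [conjS_apply]
  rw [h1, integral_sandwich_mul, conj_expDist, P.conj_mul, P.conj_mul, conjS_conjS, P.mul_assoc]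

theorem sandwich_add (f : 𝓢(Phase E, ℂ)) (u v : 𝓢'(Phase E, ℂ)) (g : 𝓢(Phase E, ℂ)) :
    sandwich hB f (u + v) g = sandwich hB f u g + sandwich hB f v g := by
  refine schwartz_ext_of_integral fun φ => ?_
  have h : ∀ w, Integrable (fun X => sandwich hB f w g X * φ X) (dX E) := fun w =>
    (SchwartzMap.pairing (ContinuousLinearMap.mul ℂ ℂ) (sandwich hB f w g) φ).integrable
  simp only [add_apply, add_mul]
  rw [integral_add (h u) (h v)]
  simp only [integral_sandwich_mul]
  rfl

theorem sandwich_smul (f : 𝓢(Phase E, ℂ)) (c : ℂ) (u : 𝓢'(Phase E, ℂ)) (g : 𝓢(Phase E, ℂ)) :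
    sandwich hB f (c • u) g = c • sandwich hB f u g := by
  refine schwartz_ext_of_integral fun φ => ?_
  have h : ∀ X, (c • sandwich hB f u g) X * φ X = c * (sandwich hB f u g X * φ X) := fun X => by
    rw [smul_apply, smul_eq_mul, _root_.mul_assoc]
  simp only [h, integral_const_mul, integral_sandwich_mul]
  rfl

end CompositionLaw

end

section

variable {E : Type*} [NormedAddCommGroup E] [InnerProductSpace ℝ E] [FiniteDimensional ℝ E]
  [MeasurableSpace E] [BorelSpace E]

open scoped LineDeriv Topology

/-! ### The kernel of `u ↦ f # u # g` -/

variable (E) in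
/-- The bilinear pairing `(a, b) ↦ ∫ a b dX` on `L²(Ξ)`. -/
def l2pair : L2 E →L[ℂ] L2 E →L[ℂ] ℂ := (ContinuousLinearMap.mul ℂ ℂ).lpPairing (dX E) 2 2

theorem l2pair_apply (a b : L2 E) : l2pair E a b = ∫ X, a X * b X ∂(dX E) := by
  rw [l2pair, ContinuousLinearMap.lpPairing_eq_integral]
  rfl

theorem l2pair_comm (a b : L2 E) : l2pair E a b = l2pair E b a := by
  simp only [l2pair_apply, mul_comm]

theorem l2pair_toLp_left (f : 𝓢(Phase E, ℂ)) (a : L2 E) :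
    l2pair E (f.toLp 2 (dX E)) a = ∫ X, f X * a X ∂(dX E) := by
  rw [l2pair_apply]
  refine integral_congr_ae ?_
  filter_upwards [f.coeFn_toLp 2 (dX E)] with X hX
  rw [hX]

theorem l2pair_toLp (f g : 𝓢(Phase E, ℂ)) :
    l2pair E (f.toLp 2 (dX E)) (g.toLp 2 (dX E)) = ∫ X, f X * g X ∂(dX E) := by
  rw [l2pair_toLp_left]
  refine integral_congr_ae ?_
  filter_upwards [g.coeFn_toLp 2 (dX E)] with X hX
  rw [hX]

theorem l2_ext_of_l2pair {a b : L2 E} (h : ∀ f : 𝓢(Phase E, ℂ),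
    l2pair E (f.toLp 2 (dX E)) a = l2pair E (f.toLp 2 (dX E)) b) : a = b := by
  have hk := LinearMap.ker_eq_bot.1 (MeasureTheory.Lp.ker_toTemperedDistributionCLM_eq_bot
    (E := Phase E) (F := ℂ) (μ := dX E) (p := 2))
  refine hk ?_
  ext f
  have h1 := h f
  rw [l2pair_toLp_left, l2pair_toLp_left] at h1
  have h2 : ∀ c : L2 E, Lp.toTemperedDistributionCLM ℂ (dX E) 2 c f = ∫ X, f X * c X ∂(dX E) :=
    fun c => Lp.toTemperedDistribution_apply c f
  exact (h2 a).trans (h1.trans (h2 b).symm)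

theorem dense_schwartz_l2 : DenseRange fun f : 𝓢(Phase E, ℂ) => (f.toLp 2 (dX E) : L2 E) :=
  SchwartzMap.denseRange_toLpCLM (by simp)

/-- The tempered distribution `φ ↦ ∫ a (D φ) dX`. -/
def weakDist (D : 𝓢(Phase E, ℂ) →L[ℂ] 𝓢(Phase E, ℂ)) (a : L2 E) : 𝓢'(Phase E, ℂ) :=
  PointwiseConvergenceCLM.precomp _ D (Lp.toTemperedDistributionCLM ℂ (dX E) 2 a)

theorem weakDist_apply (D : 𝓢(Phase E, ℂ) →L[ℂ] 𝓢(Phase E, ℂ)) (a : L2 E) (f : 𝓢(Phase E, ℂ)) :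
    weakDist D a f = l2pair E ((D f).toLp 2 (dX E)) a :=
  (Lp.toTemperedDistribution_apply a (D f)).trans (l2pair_toLp_left _ _).symm

namespace CompositionLaw

variable {P : CompositionLaw E} (hB : P.HypothesisB)

/-- The operator `a ↦ D₂ (f # (a ∘ D₁) # g)` on `L²(Ξ)`. -/
def sandwichOp (f g : 𝓢(Phase E, ℂ)) (D₁ D₂ : 𝓢(Phase E, ℂ) →L[ℂ] 𝓢(Phase E, ℂ)) :
    L2 E →ₗ[ℂ] L2 E where
  toFun a := (D₂ (sandwich hB f (weakDist D₁ a) g)).toLp 2 (dX E)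
  map_add' a b := by
    have h : weakDist D₁ (a + b) = weakDist D₁ a + weakDist D₁ b := by
      simp only [weakDist, map_add]
    rw [h, sandwich_add, map_add]
    exact map_add (SchwartzMap.toLpCLM ℂ ℂ 2 (dX E)) _ _
  map_smul' c a := by
    have h : weakDist D₁ (c • a) = c • weakDist D₁ a := by
      simp only [weakDist, map_smul]
    rw [h, sandwich_smul, map_smul]
    exact map_smul (SchwartzMap.toLpCLM ℂ ℂ 2 (dX E)) _ _

theorem l2pair_sandwichOp (f g : 𝓢(Phase E, ℂ)) {D₁ D₂ D₂' : 𝓢(Phase E, ℂ) →L[ℂ] 𝓢(Phase E, ℂ)}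
    (h₂ : IsTranspose D₂ D₂') (φ : 𝓢(Phase E, ℂ)) (a : L2 E) :
    l2pair E (φ.toLp 2 (dX E)) (sandwichOp hB f g D₁ D₂ a) =
      l2pair E ((D₁ (P.mul (P.mul g (D₂' φ)) f)).toLp 2 (dX E)) a := by
  rw [sandwichOp, l2pair_comm]
  simp only [LinearMap.coe_mk, AddHom.coe_mk]
  rw [l2pair_toLp, h₂, integral_sandwich_mul, weakDist_apply]

/-- Hypothesis (B) asserts no continuity in u; the closed graph theorem supplies it. The limit is
identified weakly: paired with a fixed φ, the operator becomes a pairing of `a` with a fixed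
Schwartz function. -/
theorem continuous_sandwichOp (f g : 𝓢(Phase E, ℂ))
    {D₁ D₂ : 𝓢(Phase E, ℂ) →L[ℂ] 𝓢(Phase E, ℂ)} (h₂ : HasTranspose D₂) :
    Continuous (sandwichOp hB f g D₁ D₂) := by
  obtain ⟨D₂', h₂⟩ := h₂
  refine LinearMap.continuous_of_seq_closed_graph _ fun u x y hu hy => ?_
  refine l2_ext_of_l2pair fun φ => ?_
  have h1 := ((l2pair E (φ.toLp 2 (dX E))).continuous.tendsto y).comp hy
  have h2 := ((l2pair E ((D₁ (P.mul (P.mul g (D₂' φ)) f)).toLp 2 (dX E))).continuous.tendsto x).comp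
    hu
  rw [l2pair_sandwichOp hB f g h₂]
  refine tendsto_nhds_unique (h1.congr fun n => ?_) h2
  exact l2pair_sandwichOp hB f g h₂ φ (u n)

theorem sandwich_weakDist (f g b : 𝓢(Phase E, ℂ)) {D D' : 𝓢(Phase E, ℂ) →L[ℂ] 𝓢(Phase E, ℂ)}
    (h : IsTranspose D D') :
    sandwich hB f (weakDist D (b.toLp 2 (dX E))) g = P.mul (P.mul f (D' b)) g := by
  refine schwartz_ext_of_integral fun φ => ?_
  rw [integral_sandwich_mul, weakDist_apply, l2pair_toLp, h, ← P.integral_mul, ← P.integral_mul,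
    P.mul_assoc (P.mul g φ), integral_mul_comm, P.mul_assoc (P.mul f (D' b))]

/-- Cyclicity of the trace when `b` is Schwartz, where the operator is an honest product
(`sandwich_weakDist`); then density. The transpose of `D₁` is needed for continuity in `b`. -/
theorem l2pair_sandwichOp_comm (f g : 𝓢(Phase E, ℂ))
    {D₁ D₂ : 𝓢(Phase E, ℂ) →L[ℂ] 𝓢(Phase E, ℂ)} (h₁ : HasTranspose D₁) (h₂ : HasTranspose D₂)
    (a b : L2 E) :
    l2pair E b (sandwichOp hB f g D₁ D₂ a) = l2pair E a (sandwichOp hB g f D₂ D₁ b) := by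
  refine dense_schwartz_l2.induction_on
    (p := fun b => l2pair E b (sandwichOp hB f g D₁ D₂ a) =
      l2pair E a (sandwichOp hB g f D₂ D₁ b)) b (isClosed_eq ?_ ?_) fun φ => ?_
  · exact ((l2pair E).flip _).continuous
  · exact (l2pair E a).continuous.comp (continuous_sandwichOp hB g f h₁)
  · obtain ⟨D₂', h₂⟩ := h₂
    rw [l2pair_sandwichOp hB f g h₂, l2pair_comm]
    simp only [sandwichOp, LinearMap.coe_mk, AddHom.coe_mk]
    rw [sandwich_weakDist hB g f φ h₂]

end CompositionLaw

/-! ### Characters as weighted square integrable functions -/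

variable (E) in
/-- A polynomial weight on `Ξ` whose inverse is square integrable. -/
def weight (Z : Phase E) : ℝ := (1 + ‖Z.1‖ ^ 2 + ‖Z.2‖ ^ 2) ^ (dX E).integrablePower

theorem weight_pos (Z : Phase E) : 0 < weight E Z := by
  unfold weight
  positivity

theorem continuous_weight : Continuous (weight E) := by
  unfold weight
  fun_prop

theorem hasTemperateGrowth_weight : (fun Z : Phase E => (weight E Z : ℂ)).HasTemperateGrowth := by
  have h1 : (fun Z : Phase E => ‖Z.1‖ ^ 2).HasTemperateGrowth :=
    (Function.hasTemperateGrowth_norm_sq E).comp (ContinuousLinearMap.fst ℝ E E).hasTemperateGrowth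
  have h2 : (fun Z : Phase E => ‖Z.2‖ ^ 2).HasTemperateGrowth :=
    (Function.hasTemperateGrowth_norm_sq E).comp (ContinuousLinearMap.snd ℝ E E).hasTemperateGrowth
  have h3 : (weight E).HasTemperateGrowth := by
    unfold weight
    fun_prop
  exact Function.HasTemperateGrowth.comp Complex.ofRealCLM.hasTemperateGrowth h3

theorem memLp_character_div_weight (X : Phase E) :
    MemLp (fun Z => character X Z / (weight E Z : ℂ)) 2 (dX E) := by
  have hc : Continuous fun Z => character X Z / (weight E Z : ℂ) :=
    (continuous_character_right X).div (Complex.continuous_ofReal.comp continuous_weight)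
      fun Z => by exact_mod_cast (weight_pos Z).ne'
  refine (memLp_two_iff_integrable_sq_norm hc.aestronglyMeasurable).2 ?_
  set k := (dX E).integrablePower with hk
  refine ((Measure.integrable_pow_neg_integrablePower (dX E)).const_mul (4 ^ k)).mono'
    (hc.norm.pow 2).aestronglyMeasurable (Filter.Eventually.of_forall fun Z => ?_)
  -- The weight uses squared norms, so as to be smooth; the 2 here becomes 2 ^ k for the weight and
  -- 4 ^ k for its square.
  have h1 : 1 + ‖Z‖ ≤ 2 * (1 + ‖Z.1‖ ^ 2 + ‖Z.2‖ ^ 2) := by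
    rw [Prod.norm_def]
    rcases max_cases ‖Z.1‖ ‖Z.2‖ with h | h <;> rw [h.1] <;>
      nlinarith [sq_nonneg (‖Z.1‖ - 1), sq_nonneg (‖Z.2‖ - 1), sq_nonneg ‖Z.1‖, sq_nonneg ‖Z.2‖]
  have h2 : (1 + ‖Z‖) ^ k ≤ 2 ^ k * weight E Z := by
    rw [weight, ← mul_pow]
    exact pow_le_pow_left₀ (by positivity) h1 k
  have h3 : 1 ≤ (1 + ‖Z‖) ^ k := one_le_pow₀ (by linarith [norm_nonneg Z])
  have h4 : (1 + ‖Z‖) ^ k ≤ 4 ^ k * weight E Z ^ 2 := by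
    calc (1 + ‖Z‖) ^ k ≤ (1 + ‖Z‖) ^ k * (1 + ‖Z‖) ^ k := le_mul_of_one_le_left (by positivity) h3
      _ ≤ (2 ^ k * weight E Z) * (2 ^ k * weight E Z) :=
        mul_le_mul h2 h2 (by positivity) (by linarith)
      _ = (2 * 2) ^ k * weight E Z ^ 2 := by rw [mul_pow]; ring
      _ = 4 ^ k * weight E Z ^ 2 := by norm_num
  rw [norm_div, norm_character, Complex.norm_real, Real.norm_of_nonneg (weight_pos Z).le,
    Real.norm_of_nonneg (by positivity), ← hk, Real.rpow_neg (by positivity), Real.rpow_natCast,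
    ← div_eq_mul_inv, div_pow, one_pow, div_le_div_iff₀ (pow_pos (weight_pos Z) 2) (by linarith)]
  linarith

/-- The function `𝔢_X` divided by `weight`, in `L²(Ξ)`. -/
def weightedCharacter (X : Phase E) : L2 E := (memLp_character_div_weight X).toLp _

/-- Since |𝔢_X| = 1. This independence of X is what makes the kernel bounds uniform. -/
theorem norm_weightedCharacter (X : Phase E) :
    ‖weightedCharacter X‖ = ‖weightedCharacter (0 : Phase E)‖ := by
  rw [weightedCharacter, weightedCharacter, Lp.norm_toLp, Lp.norm_toLp]
  congr 1
  refine eLpNorm_congr_norm_ae (Filter.Eventually.of_forall fun Z => ?_)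
  simp only [norm_div, norm_character]

variable (E) in
/-- Multiplication by `weight` on `𝓢(Ξ)`. -/
def mulWeight : 𝓢(Phase E, ℂ) →L[ℂ] 𝓢(Phase E, ℂ) :=
  SchwartzMap.smulLeftCLM ℂ fun Z => (weight E Z : ℂ)

theorem expDist_eq_l2pair (X : Phase E) (f : 𝓢(Phase E, ℂ)) :
    expDist X f = l2pair E ((mulWeight E f).toLp 2 (dX E)) (weightedCharacter X) := by
  rw [l2pair_toLp_left, expDist_eq_integral]
  refine integral_congr_ae ?_
  filter_upwards [(memLp_character_div_weight X).coeFn_toLp] with Z hZ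
  have hw : (weight E Z : ℂ) ≠ 0 := by exact_mod_cast (weight_pos Z).ne'
  rw [weightedCharacter, hZ, mulWeight,
    SchwartzMap.smulLeftCLM_apply_apply hasTemperateGrowth_weight, smul_eq_mul]
  field_simp

theorem precomp_expDist_eq_weakDist (D : 𝓢(Phase E, ℂ) →L[ℂ] 𝓢(Phase E, ℂ)) (W : Phase E) :
    PointwiseConvergenceCLM.precomp _ D (expDist W) =
      weakDist (mulWeight E ∘L D) (weightedCharacter W) := by
  ext f
  rw [weakDist_apply]
  exact expDist_eq_l2pair W (D f)

/-! ### The kernel ⟨𝔢_X, f # 𝔢_W # g⟩ is a Schwartz function -/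

namespace CompositionLaw

variable {P : CompositionLaw E} (hB : P.HypothesisB)

/-- The Schwartz function `f # (𝔢_W ∘ D) # g`. -/
def sandwichExp (f g : 𝓢(Phase E, ℂ)) (D : 𝓢(Phase E, ℂ) →L[ℂ] 𝓢(Phase E, ℂ)) (W : Phase E) :
    𝓢(Phase E, ℂ) :=
  sandwich hB f (PointwiseConvergenceCLM.precomp _ D (expDist W)) g

/-- The function `(W, X) ↦ ⟨𝔢_X, D₂ (f # (𝔢_W ∘ D₁) # g)⟩`. -/
def expKernel (f g : 𝓢(Phase E, ℂ)) (D₁ D₂ : 𝓢(Phase E, ℂ) →L[ℂ] 𝓢(Phase E, ℂ))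
    (p : Phase E × Phase E) : ℂ :=
  expDist p.2 (D₂ (sandwichExp hB f g D₁ p.1))

/-- The weights that make the characters square integrable are absorbed into `D₁` and `D₂`; the
kernel becomes a matrix element of an operator on L², bounded when `D₂` has a transpose. -/
theorem expKernel_eq_l2pair (f g : 𝓢(Phase E, ℂ)) (D₁ D₂ : 𝓢(Phase E, ℂ) →L[ℂ] 𝓢(Phase E, ℂ))
    (p : Phase E × Phase E) :
    expKernel hB f g D₁ D₂ p = l2pair E (weightedCharacter p.2)
      (sandwichOp hB f g (mulWeight E ∘L D₁) (mulWeight E ∘L D₂) (weightedCharacter p.1)) := by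
  rw [expKernel, expDist_eq_l2pair, sandwichExp, precomp_expDist_eq_weakDist, l2pair_comm]
  rfl

theorem hasTranspose_mulWeight : HasTranspose (mulWeight E) :=
  hasTranspose_smulLeftCLM hasTemperateGrowth_weight

/-- Formally the cyclicity of ∫ 𝔢_Y # f # 𝔢_X # g. It yields all regularity in the first variable
from that in the second. -/
theorem expKernel_swap (f g : 𝓢(Phase E, ℂ)) {D₁ D₂ : 𝓢(Phase E, ℂ) →L[ℂ] 𝓢(Phase E, ℂ)}
    (h₁ : HasTranspose D₁) (h₂ : HasTranspose D₂) (X Y : Phase E) :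
    expKernel hB f g D₁ D₂ (X, Y) = expKernel hB g f D₂ D₁ (Y, X) := by
  rw [expKernel_eq_l2pair, expKernel_eq_l2pair]
  exact l2pair_sandwichOp_comm hB f g (hasTranspose_mulWeight.comp h₁)
    (hasTranspose_mulWeight.comp h₂) _ _

theorem exists_expKernel_le (f g : 𝓢(Phase E, ℂ)) (D₁ : 𝓢(Phase E, ℂ) →L[ℂ] 𝓢(Phase E, ℂ))
    {D₂ : 𝓢(Phase E, ℂ) →L[ℂ] 𝓢(Phase E, ℂ)} (h₂ : HasTranspose D₂) :
    ∃ C, ∀ p, ‖expKernel hB f g D₁ D₂ p‖ ≤ C := by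
  let T : L2 E →L[ℂ] L2 E := ⟨sandwichOp hB f g (mulWeight E ∘L D₁) (mulWeight E ∘L D₂),
    continuous_sandwichOp hB f g (hasTranspose_mulWeight.comp h₂)⟩
  refine ⟨‖l2pair E‖ * ‖weightedCharacter (0 : Phase E)‖ *
    (‖T‖ * ‖weightedCharacter (0 : Phase E)‖), fun p => ?_⟩
  rw [expKernel_eq_l2pair]
  refine ((l2pair E).le_opNorm₂ _ (T (weightedCharacter p.1))).trans ?_
  rw [norm_weightedCharacter p.2]
  gcongr
  refine (T.le_opNorm _).trans ?_
  rw [norm_weightedCharacter p.1]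

theorem fderiv_expKernel_right (f g : 𝓢(Phase E, ℂ))
    (D₁ D₂ : 𝓢(Phase E, ℂ) →L[ℂ] 𝓢(Phase E, ℂ)) (X Y v : Phase E) :
    fderiv ℝ (fun Y => expKernel hB f g D₁ D₂ (X, Y)) Y v =
      expKernel hB f g D₁ (mulSymp v ∘L D₂) (X, Y) :=
  fderiv_expDist (D₂ (sandwichExp hB f g D₁ X)) Y v

/-- The factor `Complex.I` solves iσ(Y, v)⟨𝔢_Y, ·⟩ = -⟨𝔢_Y, ∂_v ·⟩ for σ(Y, v)⟨𝔢_Y, ·⟩. -/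
theorem symp_mul_expKernel_right (f g : 𝓢(Phase E, ℂ))
    (D₁ D₂ : 𝓢(Phase E, ℂ) →L[ℂ] 𝓢(Phase E, ℂ)) (X Y v : Phase E) :
    symp Y v * expKernel hB f g D₁ D₂ (X, Y) =
      expKernel hB f g D₁
        (Complex.I • (LineDeriv.lineDerivOpCLM ℂ 𝓢(Phase E, ℂ) v ∘L D₂)) (X, Y) := by
  have h : expKernel hB f g D₁ (Complex.I • (LineDeriv.lineDerivOpCLM ℂ 𝓢(Phase E, ℂ) v ∘L D₂))
      (X, Y) = Complex.I * expDist Y (∂_{v} (D₂ (sandwichExp hB f g D₁ X))) :=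
    map_smul (expDist Y) _ _
  rw [h, ← neg_eq_iff_eq_neg.2 (symp_mul_expDist _ Y v)]
  have h' : expKernel hB f g D₁ D₂ (X, Y) = expDist Y (D₂ (sandwichExp hB f g D₁ X)) := rfl
  rw [h']
  linear_combination (symp Y v * expDist Y (D₂ (sandwichExp hB f g D₁ X))) * Complex.I_mul_I

/-- Leaving `D₁` and `D₂` free closes the class: a derivative composes one of them with `mulSymp`, a
multiplication with a line derivative. Transposes are required for boundedness and for the swap, and
survive composition. -/
theorem isSchwartzClass_expKernel (f g : 𝓢(Phase E, ℂ)) :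
    IsSchwartzClass {G | ∃ D₁ D₂ : 𝓢(Phase E, ℂ) →L[ℂ] 𝓢(Phase E, ℂ),
      HasTranspose D₁ ∧ HasTranspose D₂ ∧ G = expKernel hB f g D₁ D₂} where
  bounded := by
    rintro _ ⟨D₁, D₂, h₁, h₂, rfl⟩
    exact exists_expKernel_le hB f g D₁ h₂
  differentiable_left := by
    rintro _ ⟨D₁, D₂, h₁, h₂, rfl⟩ Y
    simp only [expKernel_swap hB f g h₁ h₂]
    exact differentiable_expDist (D₁ (sandwichExp hB g f D₂ Y))
  differentiable_right := by
    rintro _ ⟨D₁, D₂, h₁, h₂, rfl⟩ X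
    exact differentiable_expDist (D₂ (sandwichExp hB f g D₁ X))
  deriv_left := by
    rintro _ ⟨D₁, D₂, h₁, h₂, rfl⟩ v
    refine ⟨mulSymp v ∘L D₁, D₂, (hasTranspose_mulSymp v).comp h₁, h₂, funext fun p => ?_⟩
    simp only [expKernel_swap hB f g h₁ h₂]
    rw [fderiv_expKernel_right, expKernel_swap hB g f h₂ ((hasTranspose_mulSymp v).comp h₁)]
  deriv_right := by
    rintro _ ⟨D₁, D₂, h₁, h₂, rfl⟩ v
    exact ⟨D₁, mulSymp v ∘L D₂, h₁, (hasTranspose_mulSymp v).comp h₂,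
      funext fun p => fderiv_expKernel_right hB f g D₁ D₂ p.1 p.2 v⟩
  mul_left := by
    rintro _ ⟨D₁, D₂, h₁, h₂, rfl⟩ l
    obtain ⟨v, hv⟩ := exists_eq_symp l
    have h₁' := ((hasTranspose_lineDeriv v).comp h₁).smul Complex.I
    refine ⟨_, D₂, h₁', h₂, funext fun p => ?_⟩
    rw [hv, ← Prod.mk.eta (p := p), expKernel_swap hB f g h₁ h₂, symp_mul_expKernel_right,
      expKernel_swap hB g f h₂ h₁']
  mul_right := by
    rintro _ ⟨D₁, D₂, h₁, h₂, rfl⟩ l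
    obtain ⟨v, hv⟩ := exists_eq_symp l
    refine ⟨D₁, _, h₁, ((hasTranspose_lineDeriv v).comp h₂).smul Complex.I, funext fun p => ?_⟩
    rw [hv]
    exact symp_mul_expKernel_right hB f g D₁ D₂ p.1 p.2 v

theorem exists_sandwichKernel (f g : 𝓢(Phase E, ℂ)) : ∃ K : 𝓢(Phase E × Phase E, ℂ),
    ∀ p, K p = expDist p.2 (sandwich hB f (expDist p.1) g) :=
  (isSchwartzClass_expKernel hB f g).exists_schwartzMap
    (expKernel hB f g (ContinuousLinearMap.id ℂ _) (ContinuousLinearMap.id ℂ _))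
    ⟨_, _, HasTranspose.id, HasTranspose.id, rfl⟩

/-- The Schwartz function `(W, X) ↦ ⟨𝔢_X, f # 𝔢_W # g⟩` on `Ξ × Ξ`. -/
def sandwichKernel (f g : 𝓢(Phase E, ℂ)) : 𝓢(Phase E × Phase E, ℂ) :=
  (exists_sandwichKernel hB f g).choose

theorem sandwichKernel_apply (f g : 𝓢(Phase E, ℂ)) (W X : Phase E) :
    sandwichKernel hB f g (W, X) = expDist X (sandwich hB f (expDist W) g) :=
  (exists_sandwichKernel hB f g).choose_spec (W, X)

theorem sandwichKernel_swap (f g : 𝓢(Phase E, ℂ)) (W X : Phase E) :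
    sandwichKernel hB f g (W, X) = sandwichKernel hB g f (X, W) := by
  rw [sandwichKernel_apply, sandwichKernel_apply]
  exact expKernel_swap hB f g HasTranspose.id HasTranspose.id W X

end CompositionLaw

end

section

variable {E : Type*} [NormedAddCommGroup E] [InnerProductSpace ℝ E] [FiniteDimensional ℝ E]
  [MeasurableSpace E] [BorelSpace E]

/-! ### Conjugation on `L²` -/

section Star

variable {α : Type*} [MeasurableSpace α] (μ : Measure α)

/-- Complex conjugation on `L²(μ)` as a conjugate linear continuous map. -/
def starLp : Lp ℂ 2 μ →L⋆[ℂ] Lp ℂ 2 μ :=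
  ContinuousLinearMap.compLpL 2 μ ((starₗᵢ ℂ : ℂ ≃ₗᵢ⋆[ℂ] ℂ) : ℂ →L⋆[ℂ] ℂ)

theorem starLp_apply (f : Lp ℂ 2 μ) : starLp μ f = star f := by
  refine Lp.ext ?_
  filter_upwards [ContinuousLinearMap.coeFn_compLpL (p := 2) (μ := μ)
    ((starₗᵢ ℂ : ℂ ≃ₗᵢ⋆[ℂ] ℂ) : ℂ →L⋆[ℂ] ℂ) f, Lp.coeFn_star f] with x h1 h2
  rw [starLp, h1, h2]
  rfl

theorem continuous_star_Lp : Continuous fun f : Lp ℂ 2 μ => star f := by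
  have h : (fun f : Lp ℂ 2 μ => star f) = starLp μ := funext fun f => (starLp_apply μ f).symm
  rw [h]
  exact (starLp μ).continuous

end Star

theorem star_toLp (f : 𝓢(Phase E, ℂ)) :
    star (f.toLp 2 (dX E)) = (conjS f).toLp 2 (dX E) := by
  refine Lp.ext ?_
  filter_upwards [Lp.coeFn_star (f.toLp 2 (dX E)), f.coeFn_toLp 2 (dX E),
    (conjS f).coeFn_toLp 2 (dX E)] with X h1 h2 h3
  rw [h1, h3, Pi.star_apply, h2]
  rfl

/-! ### Tensor products -/

theorem coeFn_tensor (f g : L2 E) : tensor f g =ᵐ[dXdY E] fun p => f p.1 * g p.2 :=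
  (memLp_tensor f g).coeFn_toLp

theorem tensor_add_left (f f' g : L2 E) : tensor (f + f') g = tensor f g + tensor f' g :=
  map_add (windowMap g) f f'

theorem tensor_smul_left (c : ℂ) (f g : L2 E) : tensor (c • f) g = c • tensor f g :=
  map_smul (windowMap g) c f

theorem tensor_add_right (f g g' : L2 E) : tensor f (g + g') = tensor f g + tensor f g' := by
  refine Lp.ext ?_
  have h5 := (Measure.quasiMeasurePreserving_snd (μ := dX E) (ν := dX E)).ae_eq_comp
    (Lp.coeFn_add g g')
  filter_upwards [coeFn_tensor f (g + g'), coeFn_tensor f g, coeFn_tensor f g',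
    Lp.coeFn_add (tensor f g) (tensor f g'), h5] with p h1 h2 h3 h4 h5
  simp only [Function.comp_apply, Pi.add_apply] at h5
  rw [h1, h4, Pi.add_apply, h2, h3, h5, mul_add]

theorem tensor_smul_right (c : ℂ) (f g : L2 E) : tensor f (c • g) = c • tensor f g := by
  refine Lp.ext ?_
  have h5 := (Measure.quasiMeasurePreserving_snd (μ := dX E) (ν := dX E)).ae_eq_comp
    (Lp.coeFn_smul c g)
  filter_upwards [coeFn_tensor f (c • g), coeFn_tensor f g, Lp.coeFn_smul c (tensor f g), h5]
    with p h1 h2 h4 h5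
  simp only [Function.comp_apply, Pi.smul_apply] at h5
  rw [h1, h4, Pi.smul_apply, h2, h5, smul_eq_mul, smul_eq_mul]
  ring

theorem inner_tensor (f₁ f₂ g₁ g₂ : L2 E) :
    inner ℂ (tensor f₁ f₂) (tensor g₁ g₂) = inner ℂ f₁ g₁ * inner ℂ f₂ g₂ := by
  simp only [L2.inner_def]
  rw [← integral_prod_mul]
  refine integral_congr_ae ?_
  filter_upwards [coeFn_tensor f₁ f₂, coeFn_tensor g₁ g₂] with p h1 h2
  rw [h1, h2]
  simp only [RCLike.inner_apply, map_mul]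
  ring

theorem norm_tensor (f g : L2 E) : ‖tensor f g‖ = ‖f‖ * ‖g‖ := by
  have h := inner_tensor f g f g
  simp only [inner_self_eq_norm_sq_to_K] at h
  have h' : ‖tensor f g‖ ^ 2 = (‖f‖ * ‖g‖) ^ 2 := by
    rw [mul_pow]
    exact_mod_cast h
  exact (pow_left_inj₀ (norm_nonneg _) (by positivity) two_ne_zero).1 h'

variable (E) in
/-- The tensor product as a continuous bilinear map. -/
def tensorL : L2 E →L[ℂ] L2 E →L[ℂ] L2Double E :=
  (LinearMap.mk₂ ℂ tensor tensor_add_left tensor_smul_left tensor_add_right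
    tensor_smul_right).mkContinuous₂ 1 fun f g => by
      rw [LinearMap.mk₂_apply, norm_tensor, one_mul]

theorem setIntegral_prod_eq_zero {F : L2Double E}
    (hF : ∀ f g : 𝓢(Phase E, ℂ), inner ℂ (tensor (f.toLp 2 (dX E)) (g.toLp 2 (dX E))) F = 0)
    {s t : Set (Phase E)} (hs : MeasurableSet s) (ht : MeasurableSet t) (hs' : dX E s ≠ ∞)
    (ht' : dX E t ≠ ∞) : ∫ p in s ×ˢ t, F p ∂(dXdY E) = 0 := by
  have h1 : ∀ f g : L2 E, inner ℂ (tensor f g) F = 0 := fun f g => by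
    refine dense_schwartz_l2.induction_on₂ (p := fun f g : L2 E => inner ℂ (tensor f g) F = 0)
      (isClosed_eq ?_ continuous_const) hF f g
    have : Continuous fun q : L2 E × L2 E => tensorL E q.1 q.2 := by fun_prop
    exact this.inner continuous_const
  have hst : dXdY E (s ×ˢ t) ≠ ∞ := by
    rw [Measure.prod_prod]
    exact ENNReal.mul_ne_top hs' ht'
  -- Orthogonality, now extended by density to all L² tensors, is applied to indicator functions.
  have h2 : tensor (indicatorConstLp 2 hs hs' (1 : ℂ)) (indicatorConstLp 2 ht ht' (1 : ℂ)) =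
      indicatorConstLp 2 (hs.prod ht) hst (1 : ℂ) := by
    refine Lp.ext ?_
    have h3 := (Measure.quasiMeasurePreserving_fst (μ := dX E) (ν := dX E)).ae_eq_comp
      (indicatorConstLp_coeFn (p := 2) (hs := hs) (hμs := hs') (c := (1 : ℂ)))
    have h4 := (Measure.quasiMeasurePreserving_snd (μ := dX E) (ν := dX E)).ae_eq_comp
      (indicatorConstLp_coeFn (p := 2) (hs := ht) (hμs := ht') (c := (1 : ℂ)))
    filter_upwards [coeFn_tensor (indicatorConstLp 2 hs hs' (1 : ℂ))
      (indicatorConstLp 2 ht ht' (1 : ℂ)), h3, h4,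
      indicatorConstLp_coeFn (p := 2) (hs := hs.prod ht) (hμs := hst) (c := (1 : ℂ))]
      with p e1 e2 e3 e4
    simp only [Function.comp_apply] at e2 e3
    rw [e1, e2, e3, e4]
    by_cases h5 : p.1 ∈ s <;> by_cases h6 : p.2 ∈ t <;> simp [Set.indicator, h5, h6]
  rw [← L2.inner_indicatorConstLp_one (𝕜 := ℂ) (hs.prod ht) hst F, ← h2, h1]

/-- Totality of elementary tensors. Integrals of F over rectangles vanish, a π-λ argument extends
this to measurable sets, and balls exhaust the space. -/
theorem eq_zero_of_inner_tensor {F : L2Double E}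
    (hF : ∀ f g : 𝓢(Phase E, ℂ), inner ℂ (tensor (f.toLp 2 (dX E)) (g.toLp 2 (dX E))) F = 0) :
    F = 0 := by
  rw [Lp.eq_zero_iff_ae_eq_zero]
  let K : ℕ → Set (Phase E) := fun n => Metric.ball 0 n
  have hKm : ∀ n, MeasurableSet (K n) := fun n => measurableSet_ball
  have hKf : ∀ n, dX E (K n) < ∞ := fun n => measure_ball_lt_top
  have hU : ⋃ n, K n ×ˢ K n = (Set.univ : Set (Phase E × Phase E)) := by
    refine Set.eq_univ_of_forall fun p => Set.mem_iUnion.2 ?_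
    obtain ⟨n, hn⟩ := exists_nat_gt (max ‖p.1‖ ‖p.2‖)
    exact ⟨n, by simpa [K] using max_lt_iff.1 hn⟩
  -- On a box of finite measure the L² function F is integrable, which the complement step of the
  -- induction requires.
  have key : ∀ n, F =ᵐ[(dXdY E).restrict (K n ×ˢ K n)] 0 := fun n => by
    have hfin : IsFiniteMeasure ((dXdY E).restrict (K n ×ˢ K n)) := by
      refine ⟨?_⟩
      rw [Measure.restrict_apply_univ, Measure.prod_prod]
      exact ENNReal.mul_lt_top (hKf n) (hKf n)
    have hint : Integrable F ((dXdY E).restrict (K n ×ˢ K n)) :=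
      ((Lp.memLp F).restrict _).integrable (by norm_num)
    have hrect : ∀ s t : Set (Phase E), MeasurableSet s → MeasurableSet t →
        ∫ p in s ×ˢ t, F p ∂((dXdY E).restrict (K n ×ˢ K n)) = 0 := fun s t hs ht => by
      rw [Measure.restrict_restrict (hs.prod ht), Set.prod_inter_prod]
      exact setIntegral_prod_eq_zero hF (hs.inter (hKm n)) (ht.inter (hKm n))
        (measure_ne_top_of_subset Set.inter_subset_right (hKf n).ne)
        (measure_ne_top_of_subset Set.inter_subset_right (hKf n).ne)
    refine hint.ae_eq_zero_of_forall_setIntegral_eq_zero fun s hs _ => ?_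
    induction s, hs using MeasurableSpace.induction_on_inter generateFrom_prod.symm
      isPiSystem_prod with
    | empty => simp
    | basic s hs =>
      obtain ⟨s, hs, t, ht, rfl⟩ := hs
      exact hrect s t hs ht
    | compl s hs ih =>
      rw [setIntegral_compl hs hint, ih (measure_lt_top _ _), sub_zero, ← setIntegral_univ,
        ← Set.univ_prod_univ]
      exact hrect _ _ MeasurableSet.univ MeasurableSet.univ
    | iUnion f hd hm ih =>
      rw [integral_iUnion hm hd hint.integrableOn]
      simp [ih _ (measure_lt_top _ _)]
  have h := (ae_restrict_iUnion_iff (μ := dXdY E) (fun n => K n ×ˢ K n) (fun p => F p = 0)).2 key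
  rwa [hU, Measure.restrict_univ] at h

variable (E) in
/-- The linear map from formal combinations of pairs of Schwartz functions to `L²(Ξ × Ξ)` given
by the tensor product. -/
def tensorSum : (𝓢(Phase E, ℂ) × 𝓢(Phase E, ℂ) →₀ ℂ) →ₗ[ℂ] L2Double E :=
  Finsupp.linearCombination ℂ fun q => tensor (q.1.toLp 2 (dX E)) (q.2.toLp 2 (dX E))

theorem denseRange_tensorSum : DenseRange (tensorSum E) := by
  have h : (LinearMap.range (tensorSum E)).topologicalClosure = ⊤ := by
    rw [Submodule.topologicalClosure_eq_top_iff, Submodule.eq_bot_iff]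
    intro F hF
    refine eq_zero_of_inner_tensor fun f g => ?_
    refine (Submodule.mem_orthogonal _ F).1 hF _ ⟨Finsupp.single (f, g) 1, ?_⟩
    rw [tensorSum, Finsupp.linearCombination_single, one_smul]
  intro F
  have : F ∈ (LinearMap.range (tensorSum E)).topologicalClosure := by rw [h]; trivial
  exact this

theorem clm_ext_tensor {M : Type*} [TopologicalSpace M] [AddCommGroup M] [Module ℂ M] [T2Space M]
    {A B : L2Double E →L[ℂ] M} (h : ∀ f g : 𝓢(Phase E, ℂ),
      A (tensor (f.toLp 2 (dX E)) (g.toLp 2 (dX E))) =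
        B (tensor (f.toLp 2 (dX E)) (g.toLp 2 (dX E)))) : A = B := by
  have h1 : A.toLinearMap ∘ₗ tensorSum E = B.toLinearMap ∘ₗ tensorSum E := by
    refine Finsupp.lhom_ext' fun q => LinearMap.ext_ring ?_
    simpa [tensorSum] using h q.1 q.2
  ext1 F
  refine congrFun (denseRange_tensorSum.equalizer A.continuous B.continuous (funext fun x => ?_)) F
  exact LinearMap.congr_fun h1 x

end

section

variable {E : Type*} [NormedAddCommGroup E] [InnerProductSpace ℝ E] [FiniteDimensional ℝ E]
  [MeasurableSpace E] [BorelSpace E]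

/-! ### The crossed product -/

-- For fixed Z the map is a translation, so (Z, p) ↦ (Z, p - (Z, Z)) preserves the measure and
-- projecting keeps null sets null. Hence `crossed` depends only on almost everywhere classes.
variable (E) in
theorem quasiMeasurePreserving_sub_diag : Measure.QuasiMeasurePreserving
    (fun q : (Phase E × Phase E) × Phase E => (q.1.1 - q.2, q.1.2 - q.2))
    ((dXdY E).prod (dX E)) (dXdY E) := by
  have h1 : MeasurePreserving (fun q : Phase E × (Phase E × Phase E) =>
      (q.1, (q.2.1 - q.1, q.2.2 - q.1))) ((dX E).prod (dXdY E)) ((dX E).prod (dXdY E)) := by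
    refine (MeasurePreserving.id (dX E)).skew_product
      (g := fun Z (p : Phase E × Phase E) => (p.1 - Z, p.2 - Z)) (by fun_prop)
      (Filter.Eventually.of_forall fun Z => ?_)
    exact (measurePreserving_sub_right (dXdY E) (Z, Z)).map_eq
  exact Measure.quasiMeasurePreserving_snd.comp
    (h1.comp Measure.measurePreserving_swap).quasiMeasurePreserving

theorem crossed_congr {F F' G G' : Phase E × Phase E → ℂ} (hF : F =ᵐ[dXdY E] F')
    (hG : G =ᵐ[dXdY E] G') : crossed F G =ᵐ[dXdY E] crossed F' G' := by
  have h1 : ∀ᵐ p ∂(dXdY E), ∀ᵐ Z ∂(dX E), F (p.1, Z) = F' (p.1, Z) :=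
    Measure.quasiMeasurePreserving_fst.ae (Measure.ae_ae_of_ae_prod hF)
  have h2 : ∀ᵐ p ∂(dXdY E), ∀ᵐ Z ∂(dX E),
      G (p.1 - Z, p.2 - Z) = G' (p.1 - Z, p.2 - Z) :=
    Measure.ae_ae_of_ae_prod ((quasiMeasurePreserving_sub_diag E).ae hG)
  filter_upwards [h1, h2] with p h1 h2
  refine integral_congr_ae ?_
  filter_upwards [h1, h2] with Z h1 h2
  rw [h1, h2]

theorem coeFn_diamond (F G : L2Double E) : diamond F G =ᵐ[dXdY E] crossed F G :=
  (memLp_crossed F G).coeFn_toLp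

/-- The Hilbert–Schmidt estimate: Cauchy–Schwarz in Z, after which the integral of |G(X - Z, Y -
Z)|² over Y and Z is ‖G‖², whatever X. With the norm inside the integral it gives both the bound for
⋄ and the integrability behind additivity. -/
theorem lintegral_crossed_le {F G : Phase E × Phase E → ℂ} (hF : StronglyMeasurable F)
    (hG : StronglyMeasurable G) :
    ∫⁻ p, (∫⁻ Z, ‖F (p.1, Z) * G (p.1 - Z, p.2 - Z)‖ₑ ∂(dX E)) ^ (2 : ℝ) ∂(dXdY E) ≤
      (∫⁻ q, ‖F q‖ₑ ^ (2 : ℝ) ∂(dXdY E)) * ∫⁻ q, ‖G q‖ₑ ^ (2 : ℝ) ∂(dXdY E) := by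
  have hFe : Measurable fun q : Phase E × Phase E => ‖F q‖ₑ ^ (2 : ℝ) :=
    hF.measurable.enorm.pow_const _
  have hGe : Measurable fun q : Phase E × Phase E => ‖G q‖ₑ ^ (2 : ℝ) :=
    hG.measurable.enorm.pow_const _
  have hpt : ∀ p : Phase E × Phase E,
      (∫⁻ Z, ‖F (p.1, Z) * G (p.1 - Z, p.2 - Z)‖ₑ ∂(dX E)) ^ (2 : ℝ) ≤
      (∫⁻ Z, ‖F (p.1, Z)‖ₑ ^ (2 : ℝ) ∂(dX E)) *
        ∫⁻ Z, ‖G (p.1 - Z, p.2 - Z)‖ₑ ^ (2 : ℝ) ∂(dX E) := by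
    intro p
    have h2 := ENNReal.lintegral_mul_le_Lp_mul_Lq (dX E) Real.HolderConjugate.two_two
      (f := fun Z => ‖F (p.1, Z)‖ₑ) (g := fun Z => ‖G (p.1 - Z, p.2 - Z)‖ₑ)
      (hF.measurable.enorm.comp (by fun_prop)).aemeasurable
      (hG.measurable.enorm.comp (by fun_prop)).aemeasurable
    simp only [enorm_mul]
    refine (ENNReal.rpow_le_rpow h2 (by norm_num)).trans (le_of_eq ?_)
    rw [ENNReal.mul_rpow_of_nonneg _ _ (by norm_num), ← ENNReal.rpow_mul, ← ENNReal.rpow_mul]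
    norm_num
  have hinner : ∀ X : Phase E,
      ∫⁻ Y, ∫⁻ Z, ‖G (X - Z, Y - Z)‖ₑ ^ (2 : ℝ) ∂(dX E) ∂(dX E) =
        ∫⁻ q, ‖G q‖ₑ ^ (2 : ℝ) ∂(dXdY E) := by
    intro X
    have hm : Measurable (Function.uncurry fun Y Z : Phase E =>
        ‖G (X - Z, Y - Z)‖ₑ ^ (2 : ℝ)) :=
      hGe.comp (g := fun q => ‖G q‖ₑ ^ (2 : ℝ)) (f := fun q : Phase E × Phase E =>
        (X - q.2, q.1 - q.2)) (by fun_prop)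
    rw [lintegral_lintegral_swap hm.aemeasurable, lintegral_prod _ hGe.aemeasurable]
    have : ∀ Z : Phase E, ∫⁻ Y, ‖G (X - Z, Y - Z)‖ₑ ^ (2 : ℝ) ∂(dX E) =
        ∫⁻ Y, ‖G (X - Z, Y)‖ₑ ^ (2 : ℝ) ∂(dX E) := fun Z =>
      lintegral_sub_right_eq_self (fun Y => ‖G (X - Z, Y)‖ₑ ^ (2 : ℝ)) Z
    simp only [this]
    exact lintegral_sub_left_eq_self (fun W => ∫⁻ Y, ‖G (W, Y)‖ₑ ^ (2 : ℝ) ∂(dX E)) X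
  have hmG : Measurable fun p : Phase E × Phase E =>
      ∫⁻ Z, ‖G (p.1 - Z, p.2 - Z)‖ₑ ^ (2 : ℝ) ∂(dX E) :=
    Measurable.lintegral_prod_right' (f := fun q : (Phase E × Phase E) × Phase E =>
      ‖G (q.1.1 - q.2, q.1.2 - q.2)‖ₑ ^ (2 : ℝ)) (hGe.comp (by fun_prop))
  have hmF : Measurable fun X : Phase E => ∫⁻ Z, ‖F (X, Z)‖ₑ ^ (2 : ℝ) ∂(dX E) :=
    hFe.lintegral_prod_right'
  have hm : Measurable fun p : Phase E × Phase E =>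
      (∫⁻ Z, ‖F (p.1, Z)‖ₑ ^ (2 : ℝ) ∂(dX E)) *
        ∫⁻ Z, ‖G (p.1 - Z, p.2 - Z)‖ₑ ^ (2 : ℝ) ∂(dX E) :=
    (hmF.comp measurable_fst).mul hmG
  refine (lintegral_mono hpt).trans (le_of_eq ?_)
  rw [lintegral_prod _ hm.aemeasurable, lintegral_prod _ hFe.aemeasurable,
    ← lintegral_mul_const _ hmF]
  refine lintegral_congr fun X => ?_
  rw [← hinner X]
  have hm' : Measurable fun Y : Phase E => ∫⁻ Z, ‖G (X - Z, Y - Z)‖ₑ ^ (2 : ℝ) ∂(dX E) :=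
    hmG.comp measurable_prodMk_left
  dsimp only
  exact lintegral_const_mul _ hm'

theorem lintegral_enorm_rpow_two (F : L2Double E) :
    ∫⁻ q, ‖F q‖ₑ ^ (2 : ℝ) ∂(dXdY E) = ‖F‖ₑ ^ (2 : ℝ) := by
  rw [Lp.enorm_def, eLpNorm_eq_lintegral_rpow_enorm_toReal (by simp) (by simp), ← ENNReal.rpow_mul]
  simp

theorem norm_diamond_le (F G : L2Double E) : ‖diamond F G‖ ≤ ‖F‖ * ‖G‖ := by
  have h : ‖diamond F G‖ₑ ^ (2 : ℝ) ≤ (‖F‖ₑ * ‖G‖ₑ) ^ (2 : ℝ) := by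
    rw [← lintegral_enorm_rpow_two, ENNReal.mul_rpow_of_nonneg _ _ (by norm_num),
      ← lintegral_enorm_rpow_two, ← lintegral_enorm_rpow_two]
    refine le_trans (lintegral_mono_ae ?_)
      (lintegral_crossed_le (Lp.stronglyMeasurable F) (Lp.stronglyMeasurable G))
    filter_upwards [coeFn_diamond F G] with p hp
    rw [hp]
    exact ENNReal.rpow_le_rpow (enorm_integral_le_lintegral_enorm _) (by norm_num)
  have h' := (ENNReal.rpow_le_rpow_iff (by norm_num)).1 h
  rw [← ENNReal.toReal_le_toReal (by simp) (ENNReal.mul_ne_top (by simp) (by simp))] at h'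
  simpa using h'

theorem ae_integrable_crossed (F G : L2Double E) :
    ∀ᵐ p ∂(dXdY E), Integrable (fun Z => F (p.1, Z) * G (p.1 - Z, p.2 - Z)) (dX E) := by
  have hF := Lp.stronglyMeasurable F
  have hG := Lp.stronglyMeasurable G
  have hH : StronglyMeasurable (fun q : (Phase E × Phase E) × Phase E =>
      F (q.1.1, q.2) * G (q.1.1 - q.2, q.1.2 - q.2)) :=
    (hF.comp_measurable (by fun_prop)).mul (hG.comp_measurable (by fun_prop))
  have hm : Measurable fun p : Phase E × Phase E =>
      (∫⁻ Z, ‖F (p.1, Z) * G (p.1 - Z, p.2 - Z)‖ₑ ∂(dX E)) ^ (2 : ℝ) :=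
    (Measurable.lintegral_prod_right' (f := fun q : (Phase E × Phase E) × Phase E =>
      ‖F (q.1.1, q.2) * G (q.1.1 - q.2, q.1.2 - q.2)‖ₑ) hH.measurable.enorm).pow_const _
  have hfin : ∫⁻ p, (∫⁻ Z, ‖F (p.1, Z) * G (p.1 - Z, p.2 - Z)‖ₑ ∂(dX E)) ^ (2 : ℝ) ∂(dXdY E) ≠ ∞ := by
    refine ne_top_of_le_ne_top ?_ (lintegral_crossed_le hF hG)
    rw [lintegral_enorm_rpow_two, lintegral_enorm_rpow_two]
    exact ENNReal.mul_ne_top (by simp) (by simp)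
  filter_upwards [ae_lt_top hm hfin] with p hp
  refine ⟨(hH.comp_measurable measurable_prodMk_left).aestronglyMeasurable, ?_⟩
  exact (ENNReal.rpow_lt_top_iff_of_pos (by norm_num)).1 hp

theorem diamond_add_left (F F' G : L2Double E) :
    diamond (F + F') G = diamond F G + diamond F' G := by
  refine Lp.ext ?_
  filter_upwards [coeFn_diamond (F + F') G, coeFn_diamond F G, coeFn_diamond F' G,
    Lp.coeFn_add (diamond F G) (diamond F' G),
    crossed_congr (Lp.coeFn_add F F') (Filter.EventuallyEq.refl _ G), ae_integrable_crossed F G,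
    ae_integrable_crossed F' G] with p h1 h2 h3 h4 h5 h6 h7
  rw [h1, h5, h4, Pi.add_apply, h2, h3]
  simp only [crossed, Pi.add_apply, add_mul]
  exact integral_add h6 h7

theorem diamond_add_right (F G G' : L2Double E) :
    diamond F (G + G') = diamond F G + diamond F G' := by
  refine Lp.ext ?_
  filter_upwards [coeFn_diamond F (G + G'), coeFn_diamond F G, coeFn_diamond F G',
    Lp.coeFn_add (diamond F G) (diamond F G'),
    crossed_congr (Filter.EventuallyEq.refl _ F) (Lp.coeFn_add G G'), ae_integrable_crossed F G,
    ae_integrable_crossed F G'] with p h1 h2 h3 h4 h5 h6 h7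
  rw [h1, h5, h4, Pi.add_apply, h2, h3]
  simp only [crossed, Pi.add_apply, mul_add]
  exact integral_add h6 h7

theorem diamond_smul_left (c : ℂ) (F G : L2Double E) : diamond (c • F) G = c • diamond F G := by
  refine Lp.ext ?_
  filter_upwards [coeFn_diamond (c • F) G, coeFn_diamond F G, Lp.coeFn_smul c (diamond F G),
    crossed_congr (Lp.coeFn_smul c F) (Filter.EventuallyEq.refl _ G)] with p h1 h2 h4 h5
  rw [h1, h5, h4, Pi.smul_apply, h2]
  simp only [crossed, Pi.smul_apply, smul_eq_mul, mul_assoc, integral_const_mul]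

theorem diamond_smul_right (c : ℂ) (F G : L2Double E) : diamond F (c • G) = c • diamond F G := by
  refine Lp.ext ?_
  filter_upwards [coeFn_diamond F (c • G), coeFn_diamond F G, Lp.coeFn_smul c (diamond F G),
    crossed_congr (Filter.EventuallyEq.refl _ F) (Lp.coeFn_smul c G)] with p h1 h2 h4 h5
  rw [h1, h5, h4, Pi.smul_apply, h2]
  simp only [crossed, Pi.smul_apply, smul_eq_mul, mul_left_comm _ c, integral_const_mul]

variable (E) in
/-- The crossed product as a continuous bilinear map. -/
def diamondL : L2Double E →L[ℂ] L2Double E →L[ℂ] L2Double E :=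
  (LinearMap.mk₂ ℂ diamond diamond_add_left diamond_smul_left diamond_add_right
    diamond_smul_right).mkContinuous₂ 1 fun F G => by
      rw [LinearMap.mk₂_apply, one_mul]
      exact norm_diamond_le F G

theorem diamondL_apply (F G : L2Double E) : diamondL E F G = diamond F G := rfl

variable (E) in
theorem measurePreserving_fst_sub :
    MeasurePreserving (fun p : Phase E × Phase E => (p.1, p.1 - p.2)) (dXdY E) (dXdY E) := by
  refine (MeasurePreserving.id (dX E)).skew_product (g := fun X Y : Phase E => X - Y)
    (by fun_prop) (Filter.Eventually.of_forall fun X => ?_)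
  exact (Measure.measurePreserving_sub_left (dX E) X).map_eq

variable (E) in
/-- The change of variables `(X, Y) ↦ (X, X - Y)` on `L²(Ξ × Ξ)`. -/
def shear : L2Double E →ₗᵢ[ℂ] L2Double E :=
  Lp.compMeasurePreservingₗᵢ ℂ _ (measurePreserving_fst_sub E)

theorem coeFn_shear (F : L2Double E) :
    shear E F =ᵐ[dXdY E] fun p => F (p.1, p.1 - p.2) :=
  Lp.coeFn_compMeasurePreserving F (measurePreserving_fst_sub E)

theorem shear_shear (F : L2Double E) : shear E (shear E F) = F := by
  refine Lp.ext ?_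
  filter_upwards [coeFn_shear (shear E F),
    (measurePreserving_fst_sub E).quasiMeasurePreserving.ae (coeFn_shear F)] with p h1 h2
  rw [h1, h2]
  simp

/-- In sheared variables ⋄ is composition of integral kernels, and elementary tensors are rank-one
operators. The substitution Z ↦ X - Z separates the variables. -/
theorem diamond_shear_tensor (u v w z : L2 E) :
    diamond (shear E (tensor u v)) (shear E (tensor w z)) =
      l2pair E v w • shear E (tensor u z) := by
  have hs : ∀ a b : L2 E, shear E (tensor a b) =ᵐ[dXdY E] fun p => a p.1 * b (p.1 - p.2) :=
    fun a b => by
      filter_upwards [coeFn_shear (tensor a b),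
        (measurePreserving_fst_sub E).quasiMeasurePreserving.ae (coeFn_tensor a b)] with p h1 h2
      rw [h1, h2]
  refine Lp.ext ?_
  filter_upwards [coeFn_diamond (shear E (tensor u v)) (shear E (tensor w z)),
    crossed_congr (hs u v) (hs w z), Lp.coeFn_smul (l2pair E v w) (shear E (tensor u z)), hs u z]
    with p h1 h2 h3 h4
  rw [h1, h2, h3, Pi.smul_apply, h4, l2pair_apply, crossed, smul_eq_mul,
    ← integral_sub_left_eq_self _ (dX E) p.1, ← integral_mul_const]
  refine integral_congr_ae (Filter.Eventually.of_forall fun Z => ?_)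
  simp only [sub_sub_sub_cancel_right]
  simp only [sub_sub_cancel]
  ring

theorem clm_ext_shear_tensor {M : Type*} [TopologicalSpace M] [AddCommGroup M] [Module ℂ M]
    [T2Space M] {A B : L2Double E →L[ℂ] M}
    (h : ∀ f g : L2 E, A (shear E (tensor f g)) = B (shear E (tensor f g))) : A = B := by
  have h1 : A ∘L (shear E).toContinuousLinearMap = B ∘L (shear E).toContinuousLinearMap :=
    clm_ext_tensor fun f g => h _ _
  ext1 F
  rw [← shear_shear F]
  exact DFunLike.congr_fun h1 (shear E F)

theorem diamond_assoc (F G K : L2Double E) :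
    diamond (diamond F G) K = diamond F (diamond G K) := by
  -- The two bracketings as continuous trilinear maps: they need to be compared only on sheared
  -- tensors, where no iterated integral occurs.
  let A : L2Double E →L[ℂ] L2Double E →L[ℂ] L2Double E →L[ℂ] L2Double E :=
    (ContinuousLinearMap.compL ℂ (L2Double E) (L2Double E) (L2Double E →L[ℂ] L2Double E)
      (diamondL E)) ∘L (diamondL E)
  let B : L2Double E →L[ℂ] L2Double E →L[ℂ] L2Double E →L[ℂ] L2Double E :=
    ((ContinuousLinearMap.compL ℂ (L2Double E) (L2Double E →L[ℂ] L2Double E)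
      (L2Double E →L[ℂ] L2Double E)).flip (diamondL E)) ∘L
      (ContinuousLinearMap.compL ℂ (L2Double E) (L2Double E) (L2Double E)) ∘L (diamondL E)
  have hA : ∀ F G K, A F G K = diamond (diamond F G) K := fun F G K => rfl
  have hB : ∀ F G K, B F G K = diamond F (diamond G K) := fun F G K => rfl
  have h : A = B := by
    refine clm_ext_shear_tensor fun f₁ f₂ => clm_ext_shear_tensor fun g₁ g₂ =>
      clm_ext_shear_tensor fun k₁ k₂ => ?_
    rw [hA, hB, diamond_shear_tensor, diamond_shear_tensor, diamond_smul_left, diamond_smul_right,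
      diamond_shear_tensor, diamond_shear_tensor, smul_smul, smul_smul, mul_comm]
  rw [← hA, h, hB]

/-! ### The involution of the crossed product -/

theorem coeFn_diamondInv (F : L2Double E) :
    diamondInv F =ᵐ[dXdY E] fun p => starRingEnd ℂ (F (p.1 - p.2, -p.2)) := by
  filter_upwards [Lp.coeFn_star (Lp.compMeasurePreserving _ (measurePreserving_involution E) F),
    Lp.coeFn_compMeasurePreserving F (measurePreserving_involution E)] with p h1 h2
  rw [diamondInv, h1, Pi.star_apply, h2]
  rfl

theorem continuous_diamondInv : Continuous (diamondInv (E := E)) :=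
  (continuous_star_Lp _).comp
    (Lp.compMeasurePreservingₗᵢ ℂ _ (measurePreserving_involution E)).continuous

theorem diamondInv_add (F G : L2Double E) : diamondInv (F + G) = diamondInv F + diamondInv G := by
  simp only [diamondInv, map_add, ← starLp_apply]

theorem diamondInv_smul (c : ℂ) (F : L2Double E) :
    diamondInv (c • F) = starRingEnd ℂ c • diamondInv F := by
  have h : Lp.compMeasurePreserving _ (measurePreserving_involution E) (c • F) =
      c • Lp.compMeasurePreserving _ (measurePreserving_involution E) F :=
    map_smul (Lp.compMeasurePreservingₗᵢ ℂ _ (measurePreserving_involution E)) c F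
  rw [diamondInv, h, ← starLp_apply, map_smulₛₗ, starLp_apply, diamondInv]

theorem diamondInv_diamondInv (F : L2Double E) : diamondInv (diamondInv F) = F := by
  refine Lp.ext ?_
  filter_upwards [coeFn_diamondInv (diamondInv F),
    (measurePreserving_involution E).quasiMeasurePreserving.ae (coeFn_diamondInv F)] with p h1 h2
  rw [h1, h2]
  simp

theorem diamondInv_diamond (F G : L2Double E) :
    diamondInv (diamond F G) = diamond (diamondInv G) (diamondInv F) := by
  refine Lp.ext ?_
  filter_upwards [coeFn_diamondInv (diamond F G),
    (measurePreserving_involution E).quasiMeasurePreserving.ae (coeFn_diamond F G),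
    coeFn_diamond (diamondInv G) (diamondInv F),
    crossed_congr (coeFn_diamondInv G) (coeFn_diamondInv F)] with p h1 h2 h3 h4
  -- The substitution is Z ↦ Z - Y, with Y = `p.2`.
  rw [h1, h2, h3, h4, crossed, crossed, ← integral_conj,
    ← integral_sub_right_eq_self _ p.2]
  refine integral_congr_ae (Filter.Eventually.of_forall fun Z => ?_)
  have e1 : p.1 - p.2 - (Z - p.2) = p.1 - Z := by abel
  have e2 : -p.2 - (Z - p.2) = -Z := by abel
  have e3 : p.1 - Z - (p.2 - Z) = p.1 - p.2 := by abel
  have e4 : -(p.2 - Z) = Z - p.2 := by abel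
  simp only [map_mul, e1, e2, e3, e4]
  ring

variable (E) in
theorem isStarAlgebra_diamond : IsStarAlgebra (diamond (E := E)) diamondInv where
  add_mul := diamond_add_left
  mul_add := diamond_add_right
  smul_mul := diamond_smul_left
  mul_smul := diamond_smul_right
  mul_assoc := diamond_assoc
  inv_add := diamondInv_add
  inv_smul := diamondInv_smul
  inv_inv := diamondInv_diamondInv
  inv_mul := diamondInv_diamond

end

section

variable {E : Type*} [NormedAddCommGroup E] [InnerProductSpace ℝ E] [FiniteDimensional ℝ E]
  [MeasurableSpace E] [BorelSpace E]

/-! ### The modulation map -/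

/-- Equal Gram matrices give equal norms. On formal combinations this also settles that N is well
defined, despite the linear relations between tensors. -/
theorem norm_linearCombination_eq_of_inner_eq {ι H H' : Type*} [NormedAddCommGroup H]
    [InnerProductSpace ℂ H] [NormedAddCommGroup H'] [InnerProductSpace ℂ H'] (v : ι → H)
    (w : ι → H') (h : ∀ i j, inner ℂ (v i) (v j) = inner ℂ (w i) (w j)) (x : ι →₀ ℂ) :
    ‖Finsupp.linearCombination ℂ v x‖ = ‖Finsupp.linearCombination ℂ w x‖ := by
  have h1 : inner ℂ (Finsupp.linearCombination ℂ v x) (Finsupp.linearCombination ℂ v x) =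
      inner ℂ (Finsupp.linearCombination ℂ w x) (Finsupp.linearCombination ℂ w x) := by
    simp only [Finsupp.linearCombination_apply, Finsupp.sum, sum_inner, inner_sum, inner_smul_left,
      inner_smul_right, h]
  rw [norm_eq_sqrt_re_inner (𝕜 := ℂ), norm_eq_sqrt_re_inner (𝕜 := ℂ), h1]

theorem l2_inner_toLp (f g : 𝓢(Phase E, ℂ)) :
    inner ℂ (f.toLp 2 (dX E) : L2 E) (g.toLp 2 (dX E)) = ∫ X, conjS f X * g X ∂(dX E) := by
  rw [L2.inner_def]
  refine integral_congr_ae ?_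
  filter_upwards [f.coeFn_toLp 2 (dX E), g.coeFn_toLp 2 (dX E)] with X h1 h2
  rw [h1, h2, RCLike.inner_apply, conjS_apply, mul_comm]

theorem inner_tensor_toLp (g₁ g₂ : 𝓢(Phase E, ℂ)) (F : L2Double E) :
    inner ℂ (tensor (g₁.toLp 2 (dX E)) (g₂.toLp 2 (dX E))) F =
      ∫ p, F p * (conjS g₁ p.1 * conjS g₂ p.2) ∂(dXdY E) := by
  rw [L2.inner_def]
  refine integral_congr_ae ?_
  filter_upwards [coeFn_tensor (g₁.toLp 2 (dX E)) (g₂.toLp 2 (dX E)),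
    Measure.quasiMeasurePreserving_fst.ae (g₁.coeFn_toLp 2 (dX E)),
    Measure.quasiMeasurePreserving_snd.ae (g₂.coeFn_toLp 2 (dX E))] with p h1 h2 h3
  rw [h1, h2, h3, RCLike.inner_apply, map_mul, conjS_apply, conjS_apply]

theorem eq_of_integral_mul_tensor {F G : L2Double E} (h : ∀ g₁ g₂ : 𝓢(Phase E, ℂ),
    ∫ p, F p * (g₁ p.1 * g₂ p.2) ∂(dXdY E) = ∫ p, G p * (g₁ p.1 * g₂ p.2) ∂(dXdY E)) : F = G := by
  refine sub_eq_zero.1 (eq_zero_of_inner_tensor fun f g => ?_)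
  rw [inner_sub_right, inner_tensor_toLp, inner_tensor_toLp, h, sub_self]

theorem IsNMap.unique {P : CompositionLaw E} {N N' : L2Double E →L[ℂ] L2Double E}
    (h : IsNMap P N) (h' : IsNMap P N') : N = N' :=
  clm_ext_tensor fun f₁ f₂ => eq_of_integral_mul_tensor fun g₁ g₂ =>
    (h f₁ f₂ g₁ g₂).trans (h' f₁ f₂ g₁ g₂).symm

theorem IsModulation.unique {P : CompositionLaw E} {M M' : L2Double E →L[ℂ] L2Double E}
    (h : IsModulation P M) (h' : IsModulation P M') : M = M' := by
  obtain ⟨N, hN, hM⟩ := h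
  obtain ⟨N', hN', hM'⟩ := h'
  obtain rfl := hN.unique hN'
  ext1 F
  exact Lp.ext ((hM F).trans (hM' F).symm)

/-! ### Orthogonality relations and the isometry N -/

namespace CompositionLaw

variable {P : CompositionLaw E} (hB : P.HypothesisB)

theorem conj_sandwichKernel (f g : 𝓢(Phase E, ℂ)) (W X : Phase E) :
    starRingEnd ℂ (sandwichKernel hB f g (W, X)) =
      sandwichKernel hB (conjS g) (conjS f) (-W, -X) := by
  rw [sandwichKernel_apply, sandwichKernel_apply, conj_expDist, conjS_sandwich]

-- The orthogonality relations. For fixed X, Parseval in Y gives ⟨Θ_{-X}(g₁ # f̄₁), f̄₂ # g₂⟩;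
-- hypothesis (C) integrates this over X, and the trace formula turns the two resulting integrals
-- into ordinary pairings.
variable {hB} in
theorem integral_conj_sandwichKernel_mul (hC : HypothesisC hB) (f₁ f₂ g₁ g₂ : 𝓢(Phase E, ℂ)) :
    ∫ p, starRingEnd ℂ (sandwichKernel hB f₂ f₁ p) * sandwichKernel hB g₂ g₁ p ∂(dXdY E) =
      (∫ X, conjS f₁ X * g₁ X ∂(dX E)) * ∫ X, conjS f₂ X * g₂ X ∂(dX E) := by
  have hint : Integrable (fun p => starRingEnd ℂ (sandwichKernel hB f₂ f₁ p) *
      sandwichKernel hB g₂ g₁ p) (dXdY E) := by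
    refine (sandwichKernel hB g₂ g₁).integrable.bdd_mul
      (c := SchwartzMap.seminorm ℂ 0 0 (sandwichKernel hB f₂ f₁))
      (Complex.continuous_conj.comp (sandwichKernel hB f₂ f₁).continuous).aestronglyMeasurable
      (Filter.Eventually.of_forall fun p => ?_)
    rw [RCLike.norm_conj]
    exact (sandwichKernel hB f₂ f₁).norm_le_seminorm ℂ p
  have hin : ∀ X : Phase E, ∫ Y, starRingEnd ℂ (sandwichKernel hB f₂ f₁ (X, Y)) *
      sandwichKernel hB g₂ g₁ (X, Y) ∂(dX E) =
      theta hB (-X) (P.mul g₁ (conjS f₁)) (P.mul (conjS f₂) g₂) := fun X => by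
    simp only [sandwichKernel_apply, conj_expDist, conjS_sandwich]
    have h := integral_expDist_mul_expDist_neg (sandwich hB g₂ (expDist X) g₁)
      (sandwich hB (conjS f₁) (expDist (-X)) (conjS f₂))
    simp only [mul_comm (expDist (-_) _)]
    rw [h, integral_sandwich_mul, theta, neg_neg, sandwich_mul, P.mul_assoc]
  rw [integral_prod _ hint]
  simp only [hin]
  rw [integral_neg_eq_self (fun X => theta hB X (P.mul g₁ (conjS f₁)) (P.mul (conjS f₂) g₂)), hC,
    P.integral_mul, P.integral_mul]
  simp only [mul_comm]

variable {hB} in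
theorem inner_sandwichKernel (hC : HypothesisC hB) (f₁ f₂ g₁ g₂ : 𝓢(Phase E, ℂ)) :
    inner ℂ ((sandwichKernel hB f₂ f₁).toLp 2 (dXdY E) : L2Double E)
        ((sandwichKernel hB g₂ g₁).toLp 2 (dXdY E)) =
      inner ℂ (tensor (f₁.toLp 2 (dX E)) (f₂.toLp 2 (dX E)))
        (tensor (g₁.toLp 2 (dX E)) (g₂.toLp 2 (dX E))) := by
  rw [inner_tensor, l2_inner_toLp, l2_inner_toLp, ← integral_conj_sandwichKernel_mul hC,
    L2.inner_def]
  refine integral_congr_ae ?_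
  filter_upwards [(sandwichKernel hB f₂ f₁).coeFn_toLp 2 (dXdY E),
    (sandwichKernel hB g₂ g₁).coeFn_toLp 2 (dXdY E)] with p h1 h2
  rw [h1, h2, RCLike.inner_apply, mul_comm]

/-- Integration against g₂ in Y and then g₁ in X replaces each character by the corresponding
symplectic Fourier transform; cyclicity restores the order of the factors. -/
theorem integral_sandwichKernel_mul (f₁ f₂ g₁ g₂ : 𝓢(Phase E, ℂ)) :
    ∫ p, sandwichKernel hB f₂ f₁ p * (g₁ p.1 * g₂ p.2) ∂(dXdY E) =
      ∫ X, P.mul (sympFourier E g₁) f₁ X * P.mul (sympFourier E g₂) f₂ X ∂(dX E) := by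
  have hint : Integrable (fun p => sandwichKernel hB f₂ f₁ p * (g₁ p.1 * g₂ p.2)) (dXdY E) :=
    (g₁.integrable.mul_prod g₂.integrable).bdd_mul
      (c := SchwartzMap.seminorm ℂ 0 0 (sandwichKernel hB f₂ f₁))
      (sandwichKernel hB f₂ f₁).continuous.aestronglyMeasurable
      (Filter.Eventually.of_forall fun p => (sandwichKernel hB f₂ f₁).norm_le_seminorm ℂ p)
  have hin : ∀ X : Phase E, ∫ Y, sandwichKernel hB f₂ f₁ (X, Y) * (g₁ X * g₂ Y) ∂(dX E) =
      expDist X (P.mul (P.mul f₁ (sympFourier E g₂)) f₂) * g₁ X := fun X => by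
    rw [← integral_sandwich_mul hB f₂ (expDist X) f₁, ← integral_expDist_mul,
      ← integral_mul_const]
    refine integral_congr_ae (Filter.Eventually.of_forall fun Y => ?_)
    simp only [sandwichKernel_apply]
    ring
  rw [integral_prod _ hint]
  simp only [hin]
  rw [integral_expDist_mul, ← P.integral_mul, ← P.integral_mul, integral_mul_comm,
    P.mul_assoc, P.mul_assoc]

/-- The linear map on formal combinations of pairs of Schwartz functions which sends `(f₁, f₂)` to
the function `(X, Y) ↦ ⟨𝔢_Y, f₂ # 𝔢_X # f₁⟩`. -/
def kernelSum : (𝓢(Phase E, ℂ) × 𝓢(Phase E, ℂ) →₀ ℂ) →ₗ[ℂ] L2Double E :=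
  Finsupp.linearCombination ℂ fun q => (sandwichKernel hB q.2 q.1).toLp 2 (dXdY E)

/-- The map `N` on `L²(Ξ × Ξ)`. -/
def nMap : L2Double E →L[ℂ] L2Double E := (kernelSum hB).extendOfNorm (tensorSum E)

section

variable {hB} (hC : HypothesisC hB)

include hC

theorem norm_kernelSum (x) : ‖kernelSum hB x‖ = ‖tensorSum E x‖ :=
  norm_linearCombination_eq_of_inner_eq _ _ (fun _ _ => inner_sandwichKernel hC _ _ _ _) x

theorem nMap_tensorSum (x) : nMap hB (tensorSum E x) = kernelSum hB x :=
  LinearMap.extendOfNorm_eq denseRange_tensorSum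
    ⟨1, fun x => by rw [norm_kernelSum hC, one_mul]⟩ x

theorem nMap_tensor (f₁ f₂ : 𝓢(Phase E, ℂ)) :
    nMap hB (tensor (f₁.toLp 2 (dX E)) (f₂.toLp 2 (dX E))) =
      (sandwichKernel hB f₂ f₁).toLp 2 (dXdY E) := by
  have h := nMap_tensorSum hC (Finsupp.single (f₁, f₂) 1)
  rwa [tensorSum, kernelSum, Finsupp.linearCombination_single, Finsupp.linearCombination_single,
    one_smul, one_smul] at h

theorem norm_nMap (F : L2Double E) : ‖nMap hB F‖ = ‖F‖ := by
  refine denseRange_tensorSum.induction_on (p := fun F => ‖nMap hB F‖ = ‖F‖) F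
    (isClosed_eq (nMap hB).continuous.norm continuous_norm) fun x => ?_
  rw [nMap_tensorSum hC, norm_kernelSum hC]

theorem isNMap_nMap : IsNMap P (nMap hB) := fun f₁ f₂ g₁ g₂ => by
  rw [← integral_sandwichKernel_mul hB, nMap_tensor hC]
  refine integral_congr_ae ?_
  filter_upwards [(sandwichKernel hB f₂ f₁).coeFn_toLp 2 (dXdY E)] with p hp
  rw [hp]

end

end CompositionLaw

variable (E) in
theorem measurePreserving_neg_fst_sub :
    MeasurePreserving (fun p : Phase E × Phase E => (-p.1, p.1 - p.2)) (dXdY E) (dXdY E) := by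
  refine (Measure.measurePreserving_neg (dX E)).skew_product (g := fun X Y : Phase E => X - Y)
    (by fun_prop) (Filter.Eventually.of_forall fun X => ?_)
  exact (Measure.measurePreserving_sub_left (dX E) X).map_eq

variable (E) in
/-- The linear change of variables `(X, Y) ↦ (-X, X - Y)`. -/
def negFstSub : (Phase E × Phase E) ≃L[ℝ] (Phase E × Phase E) :=
  LinearEquiv.toContinuousLinearEquiv
    { toFun := fun p => (-p.1, p.1 - p.2)
      invFun := fun p => (-p.1, -p.1 - p.2)
      map_add' := fun p q => by
        ext1
        · simp [add_comm]
        · simp only [Prod.fst_add, Prod.snd_add]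
          abel
      map_smul' := fun c p => by simp [smul_sub]
      left_inv := fun p => by simp
      right_inv := fun p => by simp }

/-! ### The modulation map and its values on Schwartz functions -/

namespace CompositionLaw

variable {P : CompositionLaw E} (hB : P.HypothesisB)

/-- The Schwartz function `(X, Y) ↦ ⟨𝔢_{-X} # f, 𝔢_{X-Y} # g⟩`. -/
def modKernel (f g : 𝓢(Phase E, ℂ)) : 𝓢(Phase E × Phase E, ℂ) :=
  SchwartzMap.compCLMOfContinuousLinearEquiv ℂ (negFstSub E) (sandwichKernel hB g f)

theorem modKernel_apply (f g : 𝓢(Phase E, ℂ)) (X Y : Phase E) :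
    modKernel hB f g (X, Y) = sandwichKernel hB g f (-X, X - Y) := rfl

/-- The modulation map as a linear isometry of `L²(Ξ × Ξ)`. -/
def modulation {hB : P.HypothesisB} (hC : HypothesisC hB) : L2Double E →ₗᵢ[ℂ] L2Double E :=
  (Lp.compMeasurePreservingₗᵢ ℂ _ (measurePreserving_neg_fst_sub E)).comp
    ⟨(nMap hB).toLinearMap, norm_nMap hC⟩

variable {hB} (hC : HypothesisC hB)

theorem coeFn_modulation (F : L2Double E) :
    modulation hC F =ᵐ[dXdY E] fun p => nMap hB F (-p.1, p.1 - p.2) :=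
  Lp.coeFn_compMeasurePreserving (nMap hB F) (measurePreserving_neg_fst_sub E)

theorem isModulation_modulation : IsModulation P (modulation hC).toContinuousLinearMap :=
  ⟨nMap hB, isNMap_nMap hC, coeFn_modulation hC⟩

theorem modulation_tensor (f g : 𝓢(Phase E, ℂ)) :
    modulation hC (tensor (f.toLp 2 (dX E)) (g.toLp 2 (dX E))) =
      (modKernel hB f g).toLp 2 (dXdY E) := by
  refine Lp.ext ?_
  filter_upwards [coeFn_modulation hC (tensor (f.toLp 2 (dX E)) (g.toLp 2 (dX E))),
    (measurePreserving_neg_fst_sub E).quasiMeasurePreserving.ae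
      ((sandwichKernel hB g f).coeFn_toLp 2 (dXdY E)),
    (modKernel hB f g).coeFn_toLp 2 (dXdY E)] with p h1 h2 h3
  rw [h1, h3, nMap_tensor hC, h2]
  rfl

-- With Z = X - W the integrand is ⟨𝔢_W, h # 𝔢_{-X} # f⟩⟨𝔢_{-W}, g # 𝔢_{X-Y} # h⟩. Parseval in W
-- leaves ⟨𝔢_{-X}, f # g # 𝔢_{X-Y} # h # h⟩, where idempotence of `h` enters.
variable (hB) in
theorem crossed_modKernel {h : 𝓢(Phase E, ℂ)} (h_idem : P.mul h h = h) (f g : 𝓢(Phase E, ℂ))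
    (p : Phase E × Phase E) :
    crossed (modKernel hB f h) (modKernel hB g h) p = modKernel hB (P.mul f g) h p := by
  obtain ⟨X, Y⟩ := p
  have h1 : ∀ W : Phase E, modKernel hB f h (X, X - W) *
      modKernel hB g h (X - (X - W), Y - (X - W)) =
      expDist W (sandwich hB h (expDist (-X)) f) *
        expDist (-W) (sandwich hB g (expDist (X - Y)) h) := fun W => by
    have e1 : X - (X - W) = W := by abel
    have e2 : W - (Y - (X - W)) = X - Y := by abel
    rw [modKernel_apply, modKernel_apply, e1, e2, sandwichKernel_swap hB h g, sandwichKernel_apply,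
      sandwichKernel_apply]
  rw [crossed, ← integral_sub_left_eq_self _ (dX E) X]
  simp only [h1]
  rw [integral_expDist_mul_expDist_neg, integral_sandwich_mul, modKernel_apply,
    sandwichKernel_swap, sandwichKernel_apply, P.mul_assoc, ← sandwich_mul, h_idem]

variable (hB) in
theorem diamond_modKernel {h : 𝓢(Phase E, ℂ)} (h_idem : P.mul h h = h) (f g : 𝓢(Phase E, ℂ)) :
    diamond ((modKernel hB f h).toLp 2 (dXdY E)) ((modKernel hB g h).toLp 2 (dXdY E)) =
      (modKernel hB (P.mul f g) h).toLp 2 (dXdY E) := by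
  refine Lp.ext ?_
  filter_upwards [coeFn_diamond ((modKernel hB f h).toLp 2 (dXdY E))
      ((modKernel hB g h).toLp 2 (dXdY E)),
    crossed_congr ((modKernel hB f h).coeFn_toLp 2 (dXdY E))
      ((modKernel hB g h).coeFn_toLp 2 (dXdY E)),
    (modKernel hB (P.mul f g) h).coeFn_toLp 2 (dXdY E)] with p h1 h2 h3
  rw [h1, h2, h3, crossed_modKernel hB h_idem]

-- Conjugation reverses the product and negates the characters, so they appear in exchanged
-- positions; `sandwichKernel_swap` puts them back, and reality of `h` keeps the window.
variable (hB) in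
theorem diamondInv_modKernel {h : 𝓢(Phase E, ℂ)} (h_real : conjS h = h) (f : 𝓢(Phase E, ℂ)) :
    diamondInv ((modKernel hB f h).toLp 2 (dXdY E)) =
      (modKernel hB (conjS f) h).toLp 2 (dXdY E) := by
  refine Lp.ext ?_
  filter_upwards [coeFn_diamondInv ((modKernel hB f h).toLp 2 (dXdY E)),
    (measurePreserving_involution E).quasiMeasurePreserving.ae
      ((modKernel hB f h).coeFn_toLp 2 (dXdY E)),
    (modKernel hB (conjS f) h).coeFn_toLp 2 (dXdY E)] with p h1 h2 h3
  obtain ⟨X, Y⟩ := p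
  rw [h1, h2, h3, modKernel_apply, modKernel_apply, conj_sandwichKernel, h_real,
    sandwichKernel_swap]
  congr 2 <;> abel

/-! ### The extension of the composition law to `L²(Ξ)` -/

/-- The isometry, up to a factor, `f ↦ M(f ⊗ h)`. -/
def localizedL (h : L2 E) : L2 E →L[ℂ] L2Double E :=
  (modulation hC).toContinuousLinearMap ∘L (tensorL E).flip h

theorem localizedL_apply (h f : L2 E) : localizedL hC h f = modulation hC (tensor f h) := rfl

/-- M is an isometry and tensors have multiplicative scalar products, so M_h^* M_h = ‖h‖². The left
inverse gives injectivity and serves to define the product on L². -/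
theorem adjoint_localizedL (h f : L2 E) :
    (localizedL hC h).adjoint (localizedL hC h f) = inner ℂ h h • f := by
  refine ext_inner_left ℂ fun g => ?_
  rw [ContinuousLinearMap.adjoint_inner_right, localizedL_apply, localizedL_apply,
    LinearIsometry.inner_map_map, inner_tensor, inner_smul_right, mul_comm]

theorem localizedL_injective {h : L2 E} (hh : h ≠ 0) : Function.Injective (localizedL hC h) := by
  intro f g hfg
  have h1 := congrArg (localizedL hC h).adjoint hfg
  rw [adjoint_localizedL, adjoint_localizedL] at h1
  exact smul_right_injective _ (inner_self_ne_zero.2 hh) h1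

/-- The composition law on `L²(Ξ)`, transported from the crossed product. -/
def l2Product (h : L2 E) : L2 E →L[ℂ] L2 E →L[ℂ] L2 E :=
  (inner ℂ h h)⁻¹ • (ContinuousLinearMap.compL ℂ (L2 E) (L2Double E) (L2 E)
    (localizedL hC h).adjoint ∘L ((diamondL E ∘L localizedL hC h).flip ∘L localizedL hC h).flip)

theorem l2Product_apply (h f g : L2 E) : l2Product hC h f g =
    (inner ℂ h h)⁻¹ • (localizedL hC h).adjoint
      (diamond (localizedL hC h f) (localizedL hC h g)) := rfl

theorem toLp_ne_zero {h : 𝓢(Phase E, ℂ)} (h_ne : h ≠ 0) : (h.toLp 2 (dX E) : L2 E) ≠ 0 :=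
  fun h0 => h_ne (SchwartzMap.injective_toLp 2 (dX E)
    (h0.trans (map_zero (SchwartzMap.toLpCLM ℂ ℂ 2 (dX E))).symm))

/-- For Schwartz f, g the crossed product of the images is itself the image of f # g, and the left
inverse recovers f # g. Thus the L² bound for `#` is inherited from ⋄. -/
theorem isL2Product_l2Product {h : 𝓢(Phase E, ℂ)} (h_idem : P.mul h h = h) (h_ne : h ≠ 0) :
    IsL2Product P (l2Product hC (h.toLp 2 (dX E))) := fun f g => by
  rw [l2Product_apply, localizedL_apply, localizedL_apply, modulation_tensor, modulation_tensor,
    diamond_modKernel hB h_idem, ← modulation_tensor hC, ← localizedL_apply, adjoint_localizedL,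
    smul_smul, inv_mul_cancel₀ (inner_self_ne_zero.2 (toLp_ne_zero h_ne)), one_smul]

end CompositionLaw

theorem IsL2Product.unique {P : CompositionLaw E} {m m' : L2 E →L[ℂ] L2 E →L[ℂ] L2 E}
    (h : IsL2Product P m) (h' : IsL2Product P m') : m = m' := by
  ext1 f
  ext1 g
  refine dense_schwartz_l2.induction_on₂ (p := fun f g : L2 E => m f g = m' f g)
    (isClosed_eq (by fun_prop) (by fun_prop)) (fun f g => ?_) f g
  rw [h, h']

/-! ### Transfer of the *-algebra structure to L²(Ξ) -/

namespace CompositionLaw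

variable {P : CompositionLaw E} {hB : P.HypothesisB} (hC : HypothesisC hB)

/-- Both sides are jointly continuous, so the identity for Schwartz functions extends by density. -/
theorem localizedL_map_mul {h : 𝓢(Phase E, ℂ)} (h_idem : P.mul h h = h)
    {m : L2 E →L[ℂ] L2 E →L[ℂ] L2 E} (hm : IsL2Product P m) (f g : L2 E) :
    localizedL hC (h.toLp 2 (dX E)) (m f g) =
      diamond (localizedL hC (h.toLp 2 (dX E)) f) (localizedL hC (h.toLp 2 (dX E)) g) := by
  refine dense_schwartz_l2.induction_on₂ (p := fun f g : L2 E =>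
    localizedL hC (h.toLp 2 (dX E)) (m f g) = diamondL E (localizedL hC (h.toLp 2 (dX E)) f)
      (localizedL hC (h.toLp 2 (dX E)) g)) (isClosed_eq (by fun_prop) (by fun_prop))
    (fun f g => ?_) f g
  rw [hm, diamondL_apply, localizedL_apply, localizedL_apply, localizedL_apply, modulation_tensor,
    modulation_tensor, modulation_tensor, diamond_modKernel hB h_idem]

theorem localizedL_map_star {h : 𝓢(Phase E, ℂ)} (h_real : conjS h = h) (f : L2 E) :
    localizedL hC (h.toLp 2 (dX E)) (star f) =
      diamondInv (localizedL hC (h.toLp 2 (dX E)) f) := by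
  refine dense_schwartz_l2.induction_on (p := fun f : L2 E =>
    localizedL hC (h.toLp 2 (dX E)) (star f) = diamondInv (localizedL hC (h.toLp 2 (dX E)) f)) f
    (isClosed_eq ((localizedL hC _).continuous.comp (continuous_star_Lp _))
      (continuous_diamondInv.comp (localizedL hC _).continuous)) fun f => ?_
  rw [star_toLp, localizedL_apply, localizedL_apply, modulation_tensor, modulation_tensor,
    diamondInv_modKernel hB h_real]

-- Associativity and the involution rule hold for ⋄ and are pulled back along the injective map M_h.
include hC in
theorem isStarAlgebra_l2Product {h : 𝓢(Phase E, ℂ)} (h_idem : P.mul h h = h)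
    (h_real : conjS h = h) (h_ne : h ≠ 0) {m : L2 E →L[ℂ] L2 E →L[ℂ] L2 E}
    (hm : IsL2Product P m) : IsStarAlgebra (fun f g : L2 E => m f g) star where
  add_mul a b c := by simp
  mul_add a b c := by simp
  smul_mul z a b := by simp
  mul_smul z a b := by simp
  mul_assoc a b c := by
    refine localizedL_injective hC (toLp_ne_zero h_ne) ?_
    simp only [localizedL_map_mul hC h_idem hm, diamond_assoc]
  inv_add a b := by simp only [← starLp_apply, map_add]
  inv_smul z a := by simp only [← starLp_apply, map_smulₛₗ]
  inv_inv a := star_star a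
  inv_mul a b := by
    refine localizedL_injective hC (toLp_ne_zero h_ne) ?_
    simp only [localizedL_map_mul hC h_idem hm, localizedL_map_star hC h_real, diamondInv_diamond]

end CompositionLaw

end

end ModulationMap

end

theorem mainTheorem5 (n : ℕ) (P : CompositionLaw (Conf n)) (hB : P.HypothesisB)
    (hC : CompositionLaw.HypothesisC hB) (h : 𝓢(Phase (Conf n), ℂ))
    (h_idem : P.mul h h = h) (h_real : conjS h = h) (h_ne : h ≠ 0) :
    (∃! m : L2 (Conf n) →L[ℂ] L2 (Conf n) →L[ℂ] L2 (Conf n), IsL2Product P m) ∧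
    (∃! M : L2Double (Conf n) →L[ℂ] L2Double (Conf n), IsModulation P M) ∧
    ∀ (m : L2 (Conf n) →L[ℂ] L2 (Conf n) →L[ℂ] L2 (Conf n))
      (M : L2Double (Conf n) →L[ℂ] L2Double (Conf n)),
      IsL2Product P m → IsModulation P M →
        IsStarAlgebra (fun f g : L2 (Conf n) => m f g) star ∧
        IsStarAlgebra (diamond (E := Conf n)) diamondInv ∧
        IsStarAlgebraMorphism (fun f g : L2 (Conf n) => m f g) star diamond diamondInv
          (localized M h) ∧
        Function.Injective (localized M h) ∧
        ∀ f : 𝓢(Phase (Conf n), ℂ), ∃ G : 𝓢(Phase (Conf n) × Phase (Conf n), ℂ),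
          localized M h (f.toLp 2 (dX (Conf n))) = G.toLp 2 (dXdY (Conf n)) := by
  have hm₀ := CompositionLaw.isL2Product_l2Product hC h_idem h_ne
  have hM₀ := CompositionLaw.isModulation_modulation hC
  refine ⟨⟨_, hm₀, fun m hm => hm.unique hm₀⟩, ⟨_, hM₀, fun M hM => hM.unique hM₀⟩,
    fun m M hm hM => ?_⟩
  -- By uniqueness the given `M` is the isometry constructed above.
  have hloc : ∀ f, localized M h f = CompositionLaw.localizedL hC (h.toLp 2 _) f := fun f => by
    rw [hM.unique hM₀]
    rfl
  refine ⟨CompositionLaw.isStarAlgebra_l2Product hC h_idem h_real h_ne hm,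
    isStarAlgebra_diamond _, ⟨fun f g => ?_, fun f => ?_⟩, fun f g hfg => ?_, fun f => ?_⟩
  · rw [hloc, hloc, hloc]
    exact CompositionLaw.localizedL_map_mul hC h_idem hm f g
  · rw [hloc, hloc]
    exact CompositionLaw.localizedL_map_star hC h_real f
  · rw [hloc, hloc] at hfg
    exact CompositionLaw.localizedL_injective hC (CompositionLaw.toLp_ne_zero h_ne) hfg
  · rw [hloc]
    exact ⟨CompositionLaw.modKernel hB f h, CompositionLaw.modulation_tensor hC f h⟩
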